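/- **Theorem 1.3.** *Model.* The input is a simple undirected graph $G=(V,E)$ without isolated vertices, with $n=|V|\ge 1$ vertices and average degree $d=2|E|/n$. Its vertices carry arbitrary distinct identifiers from $\mathbb N$; the graph and $n$ are unknown, and vertices are accessed through their identifiers. A randomized adaptive algorithm makes queries at unit cost and outputs a real number. The base model with random edges has the queries RandVert() (a uniformly random vertex), RandEdge() (a uniformly random edge), RandNbr($x$) (a uniformly random neighbor of $x$) and Degree($x$). The full adjacency model with random edges additionally has Pair($x,y$) (whether $\{x,y\}\in E$) and FullNbrHood($x$) (the set of all neighbors of $x$). (a) There are constants $C>0$ and $p\in\mathbb N$ such that for every $\varepsilon\in(0,1)$ there is an algorithm in the base model with random edges, which queries only vertices returned by its earlier queries, such that for every input graph, with probability greater than $0.99$, the algorithm outputs some $\hat d$ with $|\hat d-d|\le\varepsilon d$ after at most $$C\,(1+\log n)^{p}\;\varepsilon^{-2}\min\bigl(d,\sqrt{n/d}\bigr)$$ queries, that is, $\widetilde O(\varepsilon^{-2}\min(d,\sqrt{n/d}))$ queries. In particular, for the same algorithm, with probability greater than $0.99$ it outputs such a $\hat d$ after at most $C\,(1+\log n)^{p}\,\varepsilon^{-2}n^{1/3}$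 queries. (b) For every $c\ge 1$ there are $\kappa>0$ and $n_0\in\mathbb N$ such that the following holds. Let an algorithm in the full adjacency model with random edges output, for every input graph, with probability greater than $2/3$, some $\hat d$ with $d/c\le\hat d\le c\,d$. Then for every $n\ge n_0$ there is an input graph with $n$ vertices on which, with probability at least $1/4$, the algorithm makes more than $\kappa\, n^{1/3}$ queries. So every constant-factor approximation of $d$ requires $\Omega(n^{1/3})$ queries, even with full adjacency access and random edges. -/

import Mathlib

open scoped ENNReal

noncomputable section

/-- An input graph: a simple undirected graph on `n ≥ 1` vertices without isolated vertices, whose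
vertices carry distinct identifiers from the unbounded universe `ℕ`. An algorithm only ever sees
identifiers, so that an identifier by itself says nothing about `n`. -/
structure InputGraph where
  n : ℕ
  n_pos : 0 < n
  graph : SimpleGraph (Fin n)
  no_isolated : ∀ v, ∃ w, graph.Adj v w
  id : Fin n ↪ ℕ

namespace InputGraph

instance (G : InputGraph) : Nonempty (Fin G.n) := ⟨⟨0, G.n_pos⟩⟩

open Classical in
theorem neighborFinset_nonempty (G : InputGraph) (v : Fin G.n) :
    (G.graph.neighborFinset v).Nonempty := by
  obtain ⟨w, hw⟩ := G.no_isolated v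
  exact ⟨w, by simpa using hw⟩

open Classical in
theorem edgeFinset_nonempty (G : InputGraph) : G.graph.edgeFinset.Nonempty := by
  obtain ⟨w, hw⟩ := G.no_isolated ⟨0, G.n_pos⟩
  exact ⟨s(⟨0, G.n_pos⟩, w), by simpa using hw⟩

/-- The average degree `d = 2m / n`. -/
def avgDeg (G : InputGraph) : ℝ := by
  classical exact 2 * (G.graph.edgeFinset.card : ℝ) / (G.n : ℝ)

/-- The vertex with identifier `x`, or `none` if `x` is not the identifier of a vertex. -/
def vertex (G : InputGraph) (x : ℕ) : Option (Fin G.n) := Function.partialInv G.id x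

end InputGraph

/-- The oracle queries; vertices are named by their identifiers. -/
inductive Query where
  | randVert : Query
  | randEdge : Query
  | randNbr (x : ℕ) : Query
  | degree (x : ℕ) : Query
  | pair (x y : ℕ) : Query
  | fullNbrHood (x : ℕ) : Query

namespace Query

/-- The type of answers to a query. The answer `none` means that the queried identifier does not
belong to a vertex. -/
def Response : Query → Type
  | randVert => ℕ
  | randEdge => Sym2 ℕ
  | randNbr _ => Option ℕ
  | degree _ => Option ℕ
  | pair _ _ => Bool
  | fullNbrHood _ => Option (Finset ℕ)

/-- The queries of the base model together with random edge samples. -/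
def IsBaseOrRandEdge : Query → Prop
  | randVert => True
  | randEdge => True
  | randNbr _ => True
  | degree _ => True
  | pair _ _ => False
  | fullNbrHood _ => False

/-- The identifiers that a query is about. -/
def ids : Query → Finset ℕ
  | randVert => ∅
  | randEdge => ∅
  | randNbr x => {x}
  | degree x => {x}
  | pair x y => {x, y}
  | fullNbrHood x => {x}

/-- The identifiers revealed by the answer to a query. -/
def revealed : (q : Query) → q.Response → Finset ℕ
  | randVert, r => ({r} : Finset ℕ)
  | randEdge, r => Sym2.toFinset (r : Sym2 ℕ)
  | randNbr _, r => Option.toFinset (r : Option ℕ)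
  | degree _, _ => ∅
  | pair _ _, _ => ∅
  | fullNbrHood _, r => Option.getD (r : Option (Finset ℕ)) ∅

end Query

open Classical in
/-- The distribution of the answer that the oracles of `G` give to a query; different calls use
independent randomness. -/
def InputGraph.answer (G : InputGraph) : (q : Query) → PMF q.Response
  | .randVert => (PMF.uniformOfFintype (Fin G.n)).map G.id
  | .randEdge =>
      (PMF.uniformOfFinset G.graph.edgeFinset G.edgeFinset_nonempty).map (Sym2.map G.id)
  | .randNbr x =>
      match G.vertex x with
      | none => PMF.pure (none : Option ℕ)
      | some v =>
          (PMF.uniformOfFinset (G.graph.neighborFinset v) (G.neighborFinset_nonempty v)).map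
            (fun w => (some (G.id w) : Option ℕ))
  | .degree x => PMF.pure ((G.vertex x).map (fun v => G.graph.degree v) : Option ℕ)
  | .pair x y =>
      PMF.pure (decide (∃ u v, G.id u = x ∧ G.id v = y ∧ G.graph.Adj u v) : Bool)
  | .fullNbrHood x =>
      PMF.pure ((G.vertex x).map (fun v => (G.graph.neighborFinset v).map G.id) :
        Option (Finset ℕ))

/-- A randomized adaptive query algorithm that outputs a real number. In each state it either stops
with an output, or makes a query and moves on to a random next state that depends on the answer.
It is not given the graph nor its number of vertices. -/
structure QueryAlgorithm where
  State : Type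
  init : PMF State
  next : State → ((q : Query) × (q.Response → PMF State)) ⊕ ℝ

namespace QueryAlgorithm

/-- Run `A` from state `s` on `G` with at most `k` further queries: the result is `some x` if `A`
stops with output `x`, and `none` if it wants to make more than `k` queries. -/
def runFrom (A : QueryAlgorithm) (G : InputGraph) : ℕ → A.State → PMF (Option ℝ)
  | 0, s =>
      match A.next s with
      | .inr x => PMF.pure (some x)
      | .inl _ => PMF.pure none
  | k + 1, s =>
      match A.next s with
      | .inr x => PMF.pure (some x)
      | .inl ⟨q, f⟩ => (G.answer q).bind fun r => (f r).bind fun s' => runFrom A G k s'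

/-- The probability that `A`, run on `G`, stops after at most `k` queries with an output in `S`. -/
def probWithin (A : QueryAlgorithm) (G : InputGraph) (k : ℕ) (S : Set ℝ) : ℝ≥0∞ :=
  (A.init.bind (A.runFrom G k)).toOuterMeasure (some '' S)

/-- The probability that `A`, run on `G`, stops with an output in `S`. -/
def prob (A : QueryAlgorithm) (G : InputGraph) (S : Set ℝ) : ℝ≥0∞ := ⨆ k, A.probWithin G k S

/-- `A.Reaches s K`: `A` can be in state `s` when `K` is the set of identifiers that the answers to
its queries have revealed so far. -/
inductive Reaches (A : QueryAlgorithm) : A.State → Finset ℕ → Prop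
  | init {s : A.State} : s ∈ A.init.support → Reaches A s ∅
  | step {s s' : A.State} {K : Finset ℕ} {q : Query} {f : q.Response → PMF A.State}
      (r : q.Response) : Reaches A s K → A.next s = .inl ⟨q, f⟩ → s' ∈ (f r).support →
      Reaches A s' (K ∪ q.revealed r)

/-- `A` works in the base model with random edge samples: it only makes queries of that model, and
only about vertices that were returned by earlier queries. -/
def InBaseModelWithRandEdge (A : QueryAlgorithm) : Prop :=
  ∀ (s : A.State) (K : Finset ℕ) (q : Query) (f : q.Response → PMF A.State),
    A.Reaches s K → A.next s = .inl ⟨q, f⟩ → q.IsBaseOrRandEdge ∧ q.ids ⊆ K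

end QueryAlgorithm

end

/-!
Upper bound. For every scale `2 ^ j`, the truncated degree `min(deg, 2 ^ j) / 2 ^ j` of a random
vertex and the weight `min(1, 2 ^ j / deg)` at the ends of a random edge have means `αⱼ` and `βⱼ`
with `d * βⱼ = 2 ^ j * αⱼ`, because a random edge hits a vertex with probability proportional to its
degree. The number of samples after which a sum reaches a given level is inversely proportional to
the mean, so that `d` can be read off the two crossing times, and one may stop as soon as some scale
has crossed both levels. By Chebyshev's inequality, with levels of order `(j + 1) * (j + 2) / ε²`,
all the crossing times of all scales are right at once with probability greater than `0.99`. At the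
scale `1` the means are `1` and `1 / d`; at a scale of order `√(2m)`, where `m = |E|`, the first one
is at least of order `√(d / n)` and the second one at least `1 / 2`. So some scale stops in time,
and `min(d, √(n / d)) ≤ n ^ (1 / 3)`.

Lower bound. The input is a clique on about `n ^ (2 / 3)` vertices together with the edges of a
matching, a random set of potential edges. With `R * n` instead of about `n / 2` matching edges,
where `R ≥ c²`, there are more vertices by a factor of about `2 * R`, but hardly more edges, since
the clique has about `n ^ (4 / 3) / 2`: the average degree changes by a factor greater than `c²`. An
oracle that does not know the matching can answer queries: random vertices are matching ends not
seen before, random edges are clique edges, and unknown potential edges are absent. Each of its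
answers is right except with probability `O(n ^ (-1 / 3))`, for either number of matching edges, so
that both inputs look the same during `κ * n ^ (1 / 3)` queries.
-/

noncomputable section

/-! ### Crossing times of sums of independent variables -/

section CrossingTime

variable {y : ℕ → ℝ} {U η μ : ℝ} {s t r : ℕ}

/-- The first `r` terms of a sequence. -/
def initialSegment {α : Type*} (ω : ℕ → α) (r : ℕ) : List α := (List.range r).map ω

lemma initialSegment_succ {α : Type*} (ω : ℕ → α) (r : ℕ) :
    initialSegment ω (r + 1) = initialSegment ω r ++ [ω r] := by
  simp [initialSegment, List.range_succ]

lemma map_initialSegment {α β : Type*} (f : α → β) (ω : ℕ → α) (r : ℕ) :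
    (initialSegment ω r).map f = initialSegment (f ∘ ω) r := List.map_map

lemma take_initialSegment {α : Type*} (ω : ℕ → α) (i r : ℕ) :
    (initialSegment ω r).take i = initialSegment ω (min i r) := by
  rw [initialSegment, ← List.map_take, List.take_range, initialSegment]

lemma sum_initialSegment (y : ℕ → ℝ) (r : ℕ) :
    (initialSegment y r).sum = ∑ i ∈ Finset.range r, y i := by
  induction r with
  | zero => simp [initialSegment]
  | succ r ih => simp [initialSegment_succ, Finset.sum_range_succ, ih]

/-- The number of leading terms of `l` after which the partial sum first reaches `U`. It is
meaningful only if the sum of `l` reaches `U`; otherwise it has the junk value `0` when `0 < U`. -/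
def crossingTime (U : ℝ) (l : List ℝ) : ℕ := sInf {i | U ≤ (l.take i).sum}

lemma crossingTime_initialSegment_mem_Ioc (hy : ∀ i, 0 ≤ y i)
    (hs : ∑ i ∈ Finset.range s, y i < U) (ht : U ≤ ∑ i ∈ Finset.range t, y i)
    (hr : U ≤ ∑ i ∈ Finset.range r, y i) :
    crossingTime U (initialSegment y r) ∈ Set.Ioc s t := by
  have hmono : Monotone fun i => ∑ k ∈ Finset.range i, y k := fun i j hij =>
    Finset.sum_le_sum_of_subset_of_nonneg (Finset.range_mono hij) fun k _ _ => hy k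
  have hmem : ∀ i, i ∈ {i | U ≤ ((initialSegment y r).take i).sum} ↔
      U ≤ ∑ k ∈ Finset.range (min i r), y k := fun i => by
    rw [Set.mem_ofPred_eq, take_initialSegment, sum_initialSegment]
  constructor
  · have hcross := (hmem _).1 (Nat.sInf_mem ⟨r, (hmem r).2 (by rwa [min_self])⟩)
    by_contra! hle
    exact (hcross.trans (hmono ((min_le_left _ _).trans hle))).not_gt hs
  · refine Nat.sInf_le ((hmem t).2 ?_)
    rcases min_choice t r with h | h <;> rwa [h]

/-- The partial sums of `y`, a sequence of terms of mean `μ`, cross the level `U` when they are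
expected to, up to a relative error of `η`. -/
def CrossesOnTime (μ U η : ℝ) (y : ℕ → ℝ) : Prop :=
  ∑ i ∈ Finset.range ⌊U * (1 - η) / μ⌋₊, y i < U ∧ U ≤ ∑ i ∈ Finset.range ⌈U * (1 + η) / μ⌉₊, y i

lemma floor_div_mul_le {a μ : ℝ} (ha : 0 ≤ a) (hμ : 0 < μ) : (⌊a / μ⌋₊ : ℝ) * μ ≤ a :=
  (le_div_iff₀ hμ).1 (Nat.floor_le (by positivity))

lemma lt_floor_div_add_one_mul (a : ℝ) (hμ : 0 < μ) : a < ((⌊a / μ⌋₊ : ℝ) + 1) * μ :=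
  (div_lt_iff₀ hμ).1 (Nat.lt_floor_add_one _)

lemma le_ceil_div_mul (a : ℝ) (hμ : 0 < μ) : a ≤ (⌈a / μ⌉₊ : ℝ) * μ :=
  (div_le_iff₀ hμ).1 (Nat.le_ceil _)

lemma ceil_div_mul_le {a μ : ℝ} (ha : 0 ≤ a) (hμ : 0 < μ) : (⌈a / μ⌉₊ : ℝ) * μ ≤ a + μ := by
  have h := mul_le_mul_of_nonneg_right (Nat.ceil_lt_add_one (div_nonneg ha hμ.le)).le hμ.le
  rwa [add_mul, div_mul_cancel₀ _ hμ.ne', one_mul] at h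

lemma CrossesOnTime.crossingTime_mul_mem_Icc (h : CrossesOnTime μ U η y) (hy : ∀ i, 0 ≤ y i)
    (hU : 0 ≤ U) (hμ : 0 < μ) (hμη : μ ≤ U * η) (hr : U ≤ ∑ i ∈ Finset.range r, y i) :
    crossingTime U (initialSegment y r) * μ ∈ Set.Icc (U * (1 - η)) (U * (1 + 2 * η)) := by
  obtain ⟨hlow, hhigh⟩ := crossingTime_initialSegment_mem_Ioc hy h.1 h.2 hr
  constructor
  · calc U * (1 - η) ≤ ((⌊U * (1 - η) / μ⌋₊ : ℝ) + 1) * μ := (lt_floor_div_add_one_mul _ hμ).le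
      _ ≤ _ := by gcongr; exact_mod_cast hlow
  · calc (crossingTime U (initialSegment y r) : ℝ) * μ ≤ ⌈U * (1 + η) / μ⌉₊ * μ := by gcongr
      _ ≤ U * (1 + η) + μ := ceil_div_mul_le (by linarith) hμ
      _ ≤ U * (1 + 2 * η) := by linarith

lemma CrossesOnTime.le_sum (h : CrossesOnTime μ U η y) (hy : ∀ i, 0 ≤ y i)
    (hr : U * (1 + η) / μ ≤ r) : U ≤ ∑ i ∈ Finset.range r, y i :=
  h.2.trans (Finset.sum_le_sum_of_subset_of_nonneg (Finset.range_mono (Nat.ceil_le.2 hr))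
    fun i _ _ => hy i)

open MeasureTheory ProbabilityTheory

variable {Ω : Type*} [MeasurableSpace Ω] {P : Measure Ω} [IsProbabilityMeasure P] {Y : ℕ → Ω → ℝ}

/-- Chebyshev's inequality, with the variance of a `[0, 1]`-valued variable bounded by its mean. -/
lemma measure_le_abs_sum_range_sub_le (hY : ∀ i, Measurable (Y i))
    (hY01 : ∀ i ω, Y i ω ∈ Set.Icc 0 1) (hind : Pairwise fun i j => Y i ⟂ᵢ[P] Y j)
    (hmean : ∀ i, P[Y i] = μ) (t : ℕ) {a : ℝ} (ha : 0 < a) :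
    P {ω | a ≤ |∑ i ∈ Finset.range t, Y i ω - t * μ|} ≤ ENNReal.ofReal (t * μ / a ^ 2) := by
  have hLp : ∀ i, MemLp (Y i) 2 P := fun i =>
    memLp_of_bounded (ae_of_all _ (hY01 i)) (hY i).aestronglyMeasurable 2
  have hsum : P[∑ i ∈ Finset.range t, Y i] = t * μ := by
    simp only [Finset.sum_apply]
    rw [integral_finsetSum _ fun i _ => (hLp i).integrable one_le_two]
    simp [hmean]
  have hvar : ∀ i, Var[Y i; P] ≤ μ := fun i =>
    calc Var[Y i; P] ≤ (1 - P[Y i]) * (P[Y i] - 0) :=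
          variance_le_sub_mul_sub (ae_of_all _ (hY01 i)) (hY i).aemeasurable
      _ ≤ μ := by rw [hmean]; nlinarith [sq_nonneg μ]
  calc P {ω | a ≤ |∑ i ∈ Finset.range t, Y i ω - t * μ|}
      = P {ω | a ≤ |(∑ i ∈ Finset.range t, Y i) ω - P[∑ i ∈ Finset.range t, Y i]|} := by
        rw [hsum]; simp only [Finset.sum_apply]
    _ ≤ ENNReal.ofReal (Var[∑ i ∈ Finset.range t, Y i; P] / a ^ 2) :=
        meas_ge_le_variance_div_sq (memLp_finsetSum' _ fun i _ => hLp i) ha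
    _ ≤ _ := by
        rw [IndepFun.variance_sum (fun i _ => hLp i) fun i _ j _ hij => hind hij]
        gcongr
        simpa using Finset.sum_le_sum fun i (_ : i ∈ Finset.range t) => hvar i

lemma measure_not_crossesOnTime_le (hY : ∀ i, Measurable (Y i))
    (hY01 : ∀ i ω, Y i ω ∈ Set.Icc 0 1) (hind : Pairwise fun i j => Y i ⟂ᵢ[P] Y j)
    (hmean : ∀ i, P[Y i] = μ) (hμ : 0 < μ) (hU : 0 < U) (hη0 : 0 < η) (hη1 : η ≤ 1)
    (hμη : μ ≤ U * η) :
    P {ω | ¬ CrossesOnTime μ U η fun i => Y i ω} ≤ ENNReal.ofReal (4 / (U * η ^ 2)) := by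
  set s := ⌊U * (1 - η) / μ⌋₊
  set t := ⌈U * (1 + η) / μ⌉₊
  have hs : (s : ℝ) * μ ≤ U * (1 - η) :=
    floor_div_mul_le (mul_nonneg hU.le (sub_nonneg.2 hη1)) hμ
  have ht : U * (1 + η) ≤ t * μ := le_ceil_div_mul _ hμ
  have ht' : (t : ℝ) * μ ≤ U * (1 + η) + μ := ceil_div_mul_le (by positivity) hμ
  have hsub : {ω | ¬ CrossesOnTime μ U η fun i => Y i ω} ⊆
      {ω | U * η ≤ |∑ i ∈ Finset.range s, Y i ω - s * μ|} ∪
        {ω | U * η ≤ |∑ i ∈ Finset.range t, Y i ω - t * μ|} := by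
    intro ω hω
    rcases not_and_or.1 hω with h | h
    · have h' : U ≤ ∑ i ∈ Finset.range s, Y i ω := not_lt.1 h
      have hdev : U * η ≤ |∑ i ∈ Finset.range s, Y i ω - s * μ| :=
        le_abs.2 (Or.inl (by linarith [h']))
      exact Or.inl hdev
    · have h' : ∑ i ∈ Finset.range t, Y i ω < U := not_le.1 h
      have hdev : U * η ≤ |∑ i ∈ Finset.range t, Y i ω - t * μ| :=
        le_abs.2 (Or.inr (by linarith [h']))
      exact Or.inr hdev
  have hUη : 0 < U * η := mul_pos hU hη0
  calc P {ω | ¬ CrossesOnTime μ U η fun i => Y i ω}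
      ≤ ENNReal.ofReal (s * μ / (U * η) ^ 2) + ENNReal.ofReal (t * μ / (U * η) ^ 2) :=
        (measure_mono hsub).trans ((measure_union_le _ _).trans (add_le_add
          (measure_le_abs_sum_range_sub_le hY hY01 hind hmean s hUη)
          (measure_le_abs_sum_range_sub_le hY hY01 hind hmean t hUη)))
    _ = ENNReal.ofReal ((s * μ + t * μ) / (U * η) ^ 2) := by
        rw [add_div, ENNReal.ofReal_add (by positivity) (by positivity)]
    _ ≤ ENNReal.ofReal (4 * U / (U * η) ^ 2) := by gcongr; nlinarith
    _ = ENNReal.ofReal (4 / (U * η ^ 2)) := by congr 1; field_simp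

end CrossingTime

/-! ### Repeated decision trees -/

section QueryTree

variable {O : Type} {m m' : ℕ}

/-- A decision tree in which every branch makes exactly `m` queries and ends with a value in `O`:
one round of an algorithm that repeats the same experiment. There are no trees without queries, so
that the position in a round determines the next query. -/
inductive QueryTree (O : Type) : ℕ → Type
  | last (q : Query) (f : q.Response → O) : QueryTree O 1
  | query {m : ℕ} (q : Query) (f : q.Response → QueryTree O m) : QueryTree O (m + 1)

namespace QueryTree

/-- The distribution of the value that the tree computes on `G`. -/
def eval (G : InputGraph) {m : ℕ} : QueryTree O m → PMF O
  | last q f => (G.answer q).map f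
  | query q f => (G.answer q).bind fun r => (f r).eval G

/-- The tree makes queries of the base model with random edges only, about vertices in `K` or
vertices returned by its earlier queries. -/
def InBaseModel {m : ℕ} : Finset ℕ → QueryTree O m → Prop
  | K, last q _ => q.IsBaseOrRandEdge ∧ q.ids ⊆ K
  | K, query q f =>
      (q.IsBaseOrRandEdge ∧ q.ids ⊆ K) ∧ ∀ r, (f r).InBaseModel (K ∪ q.revealed r)

lemma InBaseModel.mono {t : QueryTree O m} {K K' : Finset ℕ} (ht : t.InBaseModel K)
    (hK : K ⊆ K') : t.InBaseModel K' := by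
  induction t generalizing K K' with
  | last q f => exact ⟨ht.1, ht.2.trans hK⟩
  | query q f ih =>
    exact ⟨⟨ht.1.1, ht.1.2.trans hK⟩, fun r => ih r (ht.2 r) (Finset.union_subset_union_left hK)⟩

end QueryTree

/-- The algorithm that runs the tree `t` again and again, until `dec`, applied to the list of the
values computed so far, says what to output. Its state consists of that list and of the rest of the
current round. -/
def sampleUntil (t : QueryTree O m) (dec : List O → Option ℝ) : QueryAlgorithm where
  State := List O × Σ m', QueryTree O m'
  init := PMF.pure ([], ⟨m, t⟩)
  next
    | (h, ⟨_, t'⟩) => match dec h with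
      | some x => .inr x
      | none => match t' with
        | .last q f => .inl ⟨q, fun r => PMF.pure (h ++ [f r], ⟨m, t⟩)⟩
        | .query q f => .inl ⟨q, fun r => PMF.pure (h, ⟨_, f r⟩)⟩

variable {t : QueryTree O m} {dec : List O → Option ℝ} {h : List O}

lemma sampleUntil_reaches_inBaseModel (ht : t.InBaseModel ∅) {s : (sampleUntil t dec).State}
    {K : Finset ℕ} (hs : (sampleUntil t dec).Reaches s K) : s.2.2.InBaseModel K := by
  induction hs with
  | init hs => rw [(PMF.mem_support_pure_iff _ _).1 hs]; exact ht
  | @step s s' K q f r _ hnext hs' ih =>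
    obtain ⟨h, m', t'⟩ := s
    cases hd : dec h with
    | some x => simp [sampleUntil, hd] at hnext
    | none =>
      cases t' with
      | last q' f' =>
        simp only [sampleUntil, hd] at hnext
        cases hnext
        rw [(PMF.mem_support_pure_iff _ _).1 hs']
        exact ht.mono (Finset.empty_subset _)
      | query q' f' =>
        simp only [sampleUntil, hd] at hnext
        cases hnext
        rw [(PMF.mem_support_pure_iff _ _).1 hs']
        exact ih.2 r

lemma sampleUntil_inBaseModelWithRandEdge (ht : t.InBaseModel ∅) :
    (sampleUntil t dec).InBaseModelWithRandEdge := by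
  rintro ⟨h, m', t'⟩ K q f hs hnext
  have ht' := sampleUntil_reaches_inBaseModel ht hs
  cases hd : dec h with
  | some x => simp [sampleUntil, hd] at hnext
  | none =>
    cases t' with
    | last q' f' =>
      simp only [sampleUntil, hd] at hnext
      cases hnext
      exact ht'
    | query q' f' =>
      simp only [sampleUntil, hd] at hnext
      cases hnext
      exact ht'.1

variable (G : InputGraph)

lemma sampleUntil_runFrom_of_eq_some {x : ℝ} (hd : dec h = some x) (k : ℕ)
    (t' : Σ m', QueryTree O m') : (sampleUntil t dec).runFrom G k (h, t') = PMF.pure (some x) := by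
  cases k <;> simp [QueryAlgorithm.runFrom, sampleUntil, hd]

lemma sampleUntil_runFrom_of_eq_none (hd : dec h = none) (k : ℕ) (t' : QueryTree O m') :
    (sampleUntil t dec).runFrom G (k + m') (h, ⟨m', t'⟩) =
      (t'.eval G).bind fun o => (sampleUntil t dec).runFrom G k (h ++ [o], ⟨m, t⟩) := by
  induction t' with
  | last q f =>
    simp only [QueryAlgorithm.runFrom, sampleUntil, hd, PMF.pure_bind, QueryTree.eval,
      PMF.bind_map, Function.comp_def]
  | query q f ih =>
    simp only [QueryTree.eval, PMF.bind_bind, ← ih, QueryAlgorithm.runFrom]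
    simp only [sampleUntil, hd, PMF.pure_bind]
    rfl

/-- Read along the sequence of samples `ω`, the stopping rule `dec` stops within `k` samples, with
an output in `S`. -/
def StopsIn (dec : List O → Option ℝ) (S : Set ℝ) (k : ℕ) (ω : ℕ → O) : Prop :=
  ∃ s ≤ k, (∃ x ∈ S, dec (initialSegment ω s) = some x) ∧
    ∀ i < s, dec (initialSegment ω i) = none

lemma StopsIn.mem {S : Set ℝ} {k r : ℕ} {ω : ℕ → O} {x : ℝ} (hω : StopsIn dec S k ω)
    (hx : dec (initialSegment ω r) = some x) (hr : ∀ i < r, dec (initialSegment ω i) = none) :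
    x ∈ S := by
  obtain ⟨s, -, ⟨x', hx', hs⟩, hbefore⟩ := hω
  rcases lt_trichotomy s r with hlt | rfl | hgt
  · simp [hr s hlt] at hs
  · rwa [Option.some.inj (hx.symm.trans hs)]
  · simp [hbefore r hgt] at hx

lemma StopsIn.lt {S : Set ℝ} {k r : ℕ} {ω : ℕ → O} (hω : StopsIn dec S k ω)
    (hr : ∀ i ≤ r, dec (initialSegment ω i) = none) : r < k := by
  obtain ⟨s, hsk, ⟨x, -, hs⟩, -⟩ := hω
  by_contra! hle
  simp [hr s (hsk.trans hle)] at hs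

lemma stopsIn_of_forall_mem {S : Set ℝ} {k : ℕ} {ω : ℕ → O} {x : ℝ}
    (hk : dec (initialSegment ω k) = some x)
    (hS : ∀ r y, dec (initialSegment ω r) = some y → y ∈ S) : StopsIn dec S k ω := by
  classical
  have hex : ∃ r, ∃ y, dec (initialSegment ω r) = some y := ⟨k, x, hk⟩
  obtain ⟨y, hy⟩ := Nat.find_spec hex
  refine ⟨Nat.find hex, Nat.find_min' hex ⟨x, hk⟩, ⟨y, hS _ y hy, hy⟩, fun i hi => ?_⟩
  exact Option.eq_none_iff_forall_ne_some.2 (not_exists.1 (Nat.find_min hex hi))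

open MeasureTheory

lemma forall_lt_length_eq_none {ω : ℕ → O} (hω : initialSegment ω h.length = h)
    (hh : ∀ i < h.length, dec (h.take i) = none) :
    ∀ i < h.length, dec (initialSegment ω i) = none := fun i hi => by
  rw [← hh i hi, ← hω, take_initialSegment, min_eq_left hi.le]

lemma initialSegment_eq_iff {ω : ℕ → O} :
    initialSegment ω h.length = h ↔ ∀ i (hi : i < h.length), ω i = h[i] := by
  simp [List.ext_getElem_iff, initialSegment]

variable [MeasurableSpace O] [MeasurableSingletonClass O]

lemma infinitePi_initialSegment_eq (p : PMF O) (h : List O) :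
    Measure.infinitePi (fun _ : ℕ => p.toMeasure) {ω | initialSegment ω h.length = h} =
      (h.map p).prod := by
  have hbox : {ω : ℕ → O | initialSegment ω h.length = h} =
      Set.pi (Finset.range h.length) fun i => {o | h[i]? = some o} := by
    ext ω
    simp only [Set.mem_pi, Finset.coe_range, Set.mem_Iio, Set.mem_ofPred_eq, initialSegment_eq_iff]
    exact forall₂_congr fun i hi => by simp [hi, eq_comm]
  have hsingleton : ∀ i (hi : i < h.length), {o | h[i]? = some o} = {h[i]} := fun i hi => by
    ext o; simp [hi, eq_comm]
  rw [hbox, Measure.infinitePi_pi _ fun i hi => by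
    rw [hsingleton i (Finset.mem_range.1 hi)]; exact measurableSet_singleton _]
  rw [Finset.prod_range, ← List.prod_ofFn]
  congr 1
  refine List.ext_getElem (by simp) fun i hi _ => ?_
  simp [PMF.toMeasure_apply_singleton]

lemma infinitePi_initialSegment_inter_stopsIn_le_of_eq_some (S : Set ℝ) (k k' : ℕ) {x : ℝ}
    (hh : ∀ i < h.length, dec (h.take i) = none) (hx : dec h = some x) :
    Measure.infinitePi (fun _ : ℕ => (t.eval G).toMeasure)
        {ω | initialSegment ω h.length = h ∧ StopsIn dec S k ω} ≤
      (h.map (t.eval G)).prod *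
        ((sampleUntil t dec).runFrom G k' (h, ⟨m, t⟩)).toOuterMeasure (some '' S) := by
  rw [sampleUntil_runFrom_of_eq_some G hx, ← infinitePi_initialSegment_eq]
  by_cases hxS : x ∈ S
  · simp only [PMF.toOuterMeasure_pure_apply, Set.mem_image, Option.some.injEq, exists_eq_right,
      hxS, if_true, mul_one]
    exact measure_mono fun ω hω => hω.1
  · refine (measure_mono_null (fun ω hω => ?_) measure_empty).trans_le zero_le
    exact hxS (hω.2.mem (by rwa [hω.1]) (forall_lt_length_eq_none hω.1 hh))

lemma infinitePi_initialSegment_inter_stopsIn_le [Countable O] (S : Set ℝ) (k : ℕ) (h : List O)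
    (hh : ∀ i < h.length, dec (h.take i) = none) :
    Measure.infinitePi (fun _ : ℕ => (t.eval G).toMeasure)
        {ω | initialSegment ω h.length = h ∧ StopsIn dec S (h.length + k) ω} ≤
      (h.map (t.eval G)).prod *
        ((sampleUntil t dec).runFrom G (m * k) (h, ⟨m, t⟩)).toOuterMeasure (some '' S) := by
  induction k generalizing h with
  | zero =>
    rcases hd : dec h with _ | x
    · refine (measure_mono_null (fun ω hω => ?_) measure_empty).trans_le zero_le
      refine (hω.2.lt fun i hi => ?_).false
      exact hi.lt_or_eq.elim (forall_lt_length_eq_none hω.1 hh i) fun hi => by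
        rw [hi, Nat.add_zero, hω.1, hd]
    · exact infinitePi_initialSegment_inter_stopsIn_le_of_eq_some G S _ _ hh hd
  | succ k ih =>
    rcases hd : dec h with _ | x
    · have hsub : {ω | initialSegment ω h.length = h ∧ StopsIn dec S (h.length + (k + 1)) ω} ⊆
          ⋃ o, {ω | initialSegment ω (h ++ [o]).length = h ++ [o] ∧
            StopsIn dec S ((h ++ [o]).length + k) ω} := fun ω hω => by
        refine Set.mem_iUnion.2 ⟨ω h.length, ?_, ?_⟩
        · rw [List.length_append, List.length_singleton, initialSegment_succ, hω.1]
        · rw [List.length_append, List.length_singleton, add_assoc, add_comm 1]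
          exact hω.2
      have hh' : ∀ o, ∀ i < (h ++ [o]).length, dec ((h ++ [o]).take i) = none := fun o i hi => by
        rw [List.length_append, List.length_singleton, Nat.lt_succ_iff] at hi
        rw [List.take_append_of_le_length hi]
        exact hi.lt_or_eq.elim (hh i) fun hi => by rw [hi, List.take_length, hd]
      calc _ ≤ ∑' o, _ := (measure_mono hsub).trans (measure_iUnion_le _)
        _ ≤ ∑' o, _ := ENNReal.tsum_le_tsum fun o => ih (h ++ [o]) (hh' o)
        _ = _ := by
          rw [Nat.mul_succ, sampleUntil_runFrom_of_eq_none G hd, PMF.toOuterMeasure_bind_apply,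
            ← ENNReal.tsum_mul_left]
          simp [mul_assoc]
    · exact infinitePi_initialSegment_inter_stopsIn_le_of_eq_some G S _ _ hh hd

lemma infinitePi_stopsIn_le [Countable O] (S : Set ℝ) (k : ℕ) :
    Measure.infinitePi (fun _ : ℕ => (t.eval G).toMeasure) {ω | StopsIn dec S k ω} ≤
      (sampleUntil t dec).probWithin G (m * k) S := by
  simpa [QueryAlgorithm.probWithin, sampleUntil, initialSegment] using
    infinitePi_initialSegment_inter_stopsIn_le (t := t) (dec := dec) G S k [] (by simp)

end QueryTree

/-! ### The degree estimator -/

section Estimator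

open MeasureTheory ProbabilityTheory

/-- The degrees of a random vertex and of the two endpoints of a random edge. -/
abbrev DegreeSample : Type := ℕ × ℕ × ℕ

/-- The degree of a random vertex, truncated at `2 ^ j` and scaled to `[0, 1]`. -/
def vertexStat (j : ℕ) (o : DegreeSample) : ℝ := min ((o.1 : ℝ) / 2 ^ j) 1

/-- The weight `min 1 (2 ^ j / deg)`, averaged over the endpoints of a random edge. An edge hits a
vertex with probability proportional to its degree, so that this estimates a sum of truncated
degrees as well. -/
def edgeStat (j : ℕ) (o : DegreeSample) : ℝ :=
  (min 1 ((2 : ℝ) ^ j / o.2.1) + min 1 ((2 : ℝ) ^ j / o.2.2)) / 2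

lemma vertexStat_mem_Icc (j : ℕ) (o : DegreeSample) : vertexStat j o ∈ Set.Icc 0 1 :=
  ⟨le_min (by positivity) zero_le_one, min_le_right _ _⟩

lemma edgeStat_mem_Icc (j : ℕ) (o : DegreeSample) : edgeStat j o ∈ Set.Icc 0 1 := by
  have h0 : ∀ b : ℕ, 0 ≤ min 1 ((2 : ℝ) ^ j / b) := fun b => le_min zero_le_one (by positivity)
  have h1 : ∀ b : ℕ, min 1 ((2 : ℝ) ^ j / b) ≤ 1 := fun b => min_le_left _ _
  rw [edgeStat]
  constructor
  · linarith [h0 o.2.1, h0 o.2.2]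
  · linarith [h1 o.2.1, h1 o.2.2]

/-- The level that the sums of the statistics at scale `2 ^ j` have to reach. The factor
`(j + 1) * (j + 2)` makes the failure probabilities of all scales summable. -/
def threshold (ε : ℝ) (j : ℕ) : ℝ := 102400 * ((j + 1) * (j + 2)) / ε ^ 2

/-- Both sums of statistics at scale `2 ^ j` have reached the threshold. -/
def ScaleDone (ε : ℝ) (h : List DegreeSample) (j : ℕ) : Prop :=
  threshold ε j ≤ (h.map (vertexStat j)).sum ∧ threshold ε j ≤ (h.map (edgeStat j)).sum

/-- The estimate of the average degree at scale `2 ^ j`. The time that a sum of i.i.d. terms takes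
to reach a level is inversely proportional to the mean of the terms. -/
def scaleEstimate (ε : ℝ) (h : List DegreeSample) (j : ℕ) : ℝ :=
  2 ^ j * crossingTime (threshold ε j) (h.map (edgeStat j)) /
    crossingTime (threshold ε j) (h.map (vertexStat j))

open Classical in
/-- The stopping rule: as soon as some scale is done, output the estimate at the finest such
scale. -/
def stoppingRule (ε : ℝ) (h : List DegreeSample) : Option ℝ :=
  if hj : ∃ j, ScaleDone ε h j then some (scaleEstimate ε h (Nat.find hj)) else none

lemma exists_scaleDone_of_stoppingRule_eq_some {ε x : ℝ} {h : List DegreeSample}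
    (hx : stoppingRule ε h = some x) : ∃ j, ScaleDone ε h j ∧ scaleEstimate ε h j = x := by
  classical
  rw [stoppingRule] at hx
  split_ifs at hx with hj
  exact ⟨_, Nat.find_spec hj, Option.some.inj hx⟩

lemma exists_stoppingRule_eq_some {ε : ℝ} {h : List DegreeSample} {j : ℕ} (hj : ScaleDone ε h j) :
    ∃ x, stoppingRule ε h = some x :=
  ⟨_, dif_pos ⟨j, hj⟩⟩

variable {ε : ℝ}

lemma threshold_pos (hε : 0 < ε) (j : ℕ) : 0 < threshold ε j := by
  rw [threshold]; positivity

lemma one_le_threshold_mul (hε0 : 0 < ε) (hε1 : ε < 1) (j : ℕ) : 1 ≤ threshold ε j * (ε / 8) := by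
  have hj : (1 : ℝ) ≤ (j + 1) * (j + 2) := by nlinarith [(j.cast_nonneg : (0 : ℝ) ≤ j)]
  rw [threshold, div_mul_eq_mul_div, le_div_iff₀ (by positivity)]
  nlinarith

lemma abs_ratio_sub_le {a b α β U τ d : ℝ} (hε0 : 0 < ε) (hε1 : ε < 1) (hα : 0 < α)
    (hU : 0 < U) (hd : 0 < d) (hdβ : d * β = τ * α)
    (ha : a * α ∈ Set.Icc (U * (1 - ε / 8)) (U * (1 + 2 * (ε / 8))))
    (hb : b * β ∈ Set.Icc (U * (1 - ε / 8)) (U * (1 + 2 * (ε / 8)))) :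
    |τ * b / a - d| ≤ ε * d := by
  obtain ⟨⟨ha1, ha2⟩, hb1, hb2⟩ := And.intro ha hb
  have haα : 0 < a * α := (mul_pos hU (by linarith)).trans_le ha1
  have ha0 : 0 < a := pos_of_mul_pos_left haα hα.le
  have hratio : τ * b / a - d = d * ((b * β - a * α) / (a * α)) := by
    rw [show τ = d * β / α by field_simp; linarith]; field_simp
  have hUε : 0 < U * ε := mul_pos hU hε0
  rw [hratio, abs_mul, abs_of_pos hd, mul_comm ε]
  gcongr
  rw [abs_div, abs_of_pos haα, div_le_iff₀ haα, abs_le]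
  constructor <;> nlinarith [mul_le_mul_of_nonneg_left ha1 hε0.le, mul_pos hUε (sub_pos.2 hε1)]

/-- All the partial sums of the statistics of `ω`, whose means are `α` and `β`, reach their
thresholds when they are expected to. -/
def AllCrossOnTime (ε : ℝ) (α β : ℕ → ℝ) (ω : ℕ → DegreeSample) : Prop :=
  ∀ j, CrossesOnTime (α j) (threshold ε j) (ε / 8) (vertexStat j ∘ ω) ∧
    CrossesOnTime (β j) (threshold ε j) (ε / 8) (edgeStat j ∘ ω)

variable {α β : ℕ → ℝ} {d : ℝ} {ω : ℕ → DegreeSample}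

lemma AllCrossOnTime.abs_sub_le (hω : AllCrossOnTime ε α β ω) (hε0 : 0 < ε) (hε1 : ε < 1)
    (hd : 0 < d) (hα : ∀ j, α j ∈ Set.Ioc 0 1) (hβ : ∀ j, β j ∈ Set.Ioc 0 1)
    (hαβ : ∀ j, d * β j = 2 ^ j * α j) {r : ℕ} {x : ℝ}
    (hx : stoppingRule ε (initialSegment ω r) = some x) : |x - d| ≤ ε * d := by
  obtain ⟨j, hj, rfl⟩ := exists_scaleDone_of_stoppingRule_eq_some hx
  have hU := threshold_pos hε0 j
  have hUε := one_le_threshold_mul hε0 hε1 j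
  rw [ScaleDone, map_initialSegment, map_initialSegment, sum_initialSegment,
    sum_initialSegment] at hj
  rw [scaleEstimate, map_initialSegment, map_initialSegment]
  refine abs_ratio_sub_le hε0 hε1 (hα j).1 hU hd (hαβ j) ?_ ?_
  · exact (hω j).1.crossingTime_mul_mem_Icc (fun i => (vertexStat_mem_Icc j (ω i)).1) hU.le
      (hα j).1 ((hα j).2.trans hUε) hj.1
  · exact (hω j).2.crossingTime_mul_mem_Icc (fun i => (edgeStat_mem_Icc j (ω i)).1) hU.le
      (hβ j).1 ((hβ j).2.trans hUε) hj.2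

lemma AllCrossOnTime.stopsIn (hω : AllCrossOnTime ε α β ω) (hε0 : 0 < ε) (hε1 : ε < 1)
    (hd : 0 < d) (hα : ∀ j, α j ∈ Set.Ioc 0 1) (hβ : ∀ j, β j ∈ Set.Ioc 0 1)
    (hαβ : ∀ j, d * β j = 2 ^ j * α j) {T j : ℕ} (hTα : threshold ε j * (1 + ε / 8) / α j ≤ T)
    (hTβ : threshold ε j * (1 + ε / 8) / β j ≤ T) :
    StopsIn (stoppingRule ε) {x | |x - d| ≤ ε * d} T ω := by
  have hdone : ScaleDone ε (initialSegment ω T) j := by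
    rw [ScaleDone, map_initialSegment, map_initialSegment, sum_initialSegment, sum_initialSegment]
    exact ⟨(hω j).1.le_sum (fun i => (vertexStat_mem_Icc j (ω i)).1) hTα,
      (hω j).2.le_sum (fun i => (edgeStat_mem_Icc j (ω i)).1) hTβ⟩
  obtain ⟨x, hx⟩ := exists_stoppingRule_eq_some hdone
  exact stopsIn_of_forall_mem hx fun r x hx => hω.abs_sub_le hε0 hε1 hd hα hβ hαβ hx

lemma infinitePi_not_crossesOnTime_le {O : Type*} [MeasurableSpace O] (ν : Measure O)
    [IsProbabilityMeasure ν] {f : O → ℝ} (hf : Measurable f) (hf01 : ∀ o, f o ∈ Set.Icc 0 1)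
    {U η : ℝ} (hμ : 0 < ν[f]) (hU : 0 < U) (hη0 : 0 < η) (hη1 : η ≤ 1) (hμη : ν[f] ≤ U * η) :
    Measure.infinitePi (fun _ : ℕ => ν) {ω | ¬ CrossesOnTime ν[f] U η (f ∘ ω)} ≤
      ENNReal.ofReal (4 / (U * η ^ 2)) := by
  refine measure_not_crossesOnTime_le (Y := fun i (ω : ℕ → O) => f (ω i))
    (fun i => hf.comp (measurable_pi_apply i)) (fun i ω => hf01 (ω i)) (fun i j hij => ?_)
    (fun i => ?_) hμ hU hη0 hη1 hμη
  · exact (iIndepFun_infinitePi (P := fun _ => ν) (X := fun _ => f) fun _ => hf).indepFun hij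
  · calc ∫ ω : ℕ → O, f (ω i) ∂Measure.infinitePi (fun _ => ν)
        = ∫ o, f o ∂(Measure.infinitePi fun _ : ℕ => ν).map (Function.eval i) :=
          (integral_map (measurable_pi_apply i).aemeasurable hf.aestronglyMeasurable).symm
      _ = ν[f] := by rw [(measurePreserving_eval_infinitePi (fun _ : ℕ => ν) i).map_eq]

lemma tsum_ofReal_one_div_succ_mul_le {c : ℝ} (hc : 0 ≤ c) :
    ∑' j : ℕ, ENNReal.ofReal (c / (((j : ℝ) + 1) * (j + 2))) ≤ ENNReal.ofReal c := by
  have htelescope : ∀ T : ℕ, ∑ j ∈ Finset.range T, c / (((j : ℝ) + 1) * (j + 2)) =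
      c - c / (T + 1) := fun T => by
    induction T with
    | zero => simp
    | succ T ih =>
      rw [Finset.sum_range_succ, ih]
      push_cast
      field_simp
      ring
  refine ENNReal.tsum_le_of_sum_range_le fun T => ?_
  rw [← ENNReal.ofReal_sum_of_nonneg fun j _ => by positivity, htelescope]
  exact ENNReal.ofReal_le_ofReal (sub_le_self _ (by positivity))

lemma infinitePi_not_allCrossOnTime_le (ν : Measure DegreeSample) [IsProbabilityMeasure ν]
    (hε0 : 0 < ε) (hε1 : ε < 1) (hα : ∀ j, ν[vertexStat j] ∈ Set.Ioc 0 1)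
    (hβ : ∀ j, ν[edgeStat j] ∈ Set.Ioc 0 1) :
    Measure.infinitePi (fun _ : ℕ => ν)
        {ω | ¬ AllCrossOnTime ε (fun j => ν[vertexStat j]) (fun j => ν[edgeStat j]) ω} ≤
      ENNReal.ofReal (1 / 200) := by
  have hfail : ∀ (f : DegreeSample → ℝ) (j : ℕ), (∀ o, f o ∈ Set.Icc 0 1) → ν[f] ∈ Set.Ioc 0 1 →
      Measure.infinitePi (fun _ : ℕ => ν)
        {ω | ¬ CrossesOnTime ν[f] (threshold ε j) (ε / 8) (f ∘ ω)} ≤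
      ENNReal.ofReal (1 / 400 / ((j + 1) * (j + 2))) := fun f j hf hμ => by
    refine (infinitePi_not_crossesOnTime_le ν (measurable_of_countable f) hf hμ.1
      (threshold_pos hε0 j) (by positivity) (by linarith)
      (hμ.2.trans (one_le_threshold_mul hε0 hε1 j))).trans_eq (congr_arg _ ?_)
    rw [threshold]
    field_simp
    norm_num
  calc _ ≤ ∑' j, (_ + _) := (measure_mono fun ω hω => by
          obtain ⟨j, hj⟩ := not_forall.1 hω
          exact Set.mem_iUnion.2 ⟨j, not_and_or.1 hj⟩).trans ((measure_iUnion_le _).trans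
            (ENNReal.tsum_le_tsum fun j => measure_union_le _ _))
    _ ≤ ∑' j : ℕ, ENNReal.ofReal (1 / 200 / ((j + 1) * (j + 2))) := by
        refine ENNReal.tsum_le_tsum fun j => (add_le_add (hfail _ j (vertexStat_mem_Icc j) (hα j))
          (hfail _ j (edgeStat_mem_Icc j) (hβ j))).trans_eq ?_
        rw [← ENNReal.ofReal_add (by positivity) (by positivity)]
        congr 1
        ring
    _ ≤ _ := tsum_ofReal_one_div_succ_mul_le (by norm_num)

lemma lt_infinitePi_stopsIn (ν : Measure DegreeSample) [IsProbabilityMeasure ν]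
    (hε0 : 0 < ε) (hε1 : ε < 1) (hd : 0 < d) (hα : ∀ j, ν[vertexStat j] ∈ Set.Ioc 0 1)
    (hβ : ∀ j, ν[edgeStat j] ∈ Set.Ioc 0 1)
    (hαβ : ∀ j, d * ν[edgeStat j] = 2 ^ j * ν[vertexStat j]) {T j : ℕ}
    (hTα : threshold ε j * (1 + ε / 8) / ν[vertexStat j] ≤ T)
    (hTβ : threshold ε j * (1 + ε / 8) / ν[edgeStat j] ≤ T) :
    99 / 100 < Measure.infinitePi (fun _ : ℕ => ν)
      {ω | StopsIn (stoppingRule ε) {x | |x - d| ≤ ε * d} T ω} := by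
  set good := {ω | AllCrossOnTime ε (fun j => ν[vertexStat j]) (fun j => ν[edgeStat j]) ω}
  have hgood : 99 / 100 < Measure.infinitePi (fun _ : ℕ => ν) good := by
    have hbad := infinitePi_not_allCrossOnTime_le ν hε0 hε1 hα hβ
    have hone : 1 ≤ Measure.infinitePi (fun _ : ℕ => ν) good + ENNReal.ofReal (1 / 200) := by
      rw [← measure_univ (μ := Measure.infinitePi fun _ : ℕ => ν), ← Set.union_compl_self good]
      exact (measure_union_le _ _).trans (add_le_add_right hbad _)
    refine lt_of_lt_of_le ?_ (tsub_le_iff_right.2 hone)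
    rw [← ENNReal.ofReal_one, ← ENNReal.ofReal_sub _ (by norm_num)]
    rw [show (99 / 100 : ℝ≥0∞) = ENNReal.ofReal (99 / 100) by
      rw [ENNReal.ofReal_div_of_pos (by norm_num)]; norm_num]
    exact (ENNReal.ofReal_lt_ofReal_iff (by norm_num)).2 (by norm_num)
  exact hgood.trans_le (measure_mono fun ω hω => hω.stopsIn hε0 hε1 hd hα hβ hαβ hTα hTβ)

end Estimator

section DegreeRound

open MeasureTheory

lemma integral_map_uniformOfFinset {α β : Type*} [Finite α] [MeasurableSpace β] [Countable β]
    [MeasurableSingletonClass β] (s : Finset α) (hs : s.Nonempty) (f : α → β) (g : β → ℝ) :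
    ∫ b, g b ∂((PMF.uniformOfFinset s hs).map f).toMeasure = (∑ a ∈ s, g (f a)) / s.card := by
  have := Fintype.ofFinite α
  let _ : MeasurableSpace α := ⊤
  rw [← PMF.toMeasure_map _ _ measurable_from_top, integral_map measurable_from_top.aemeasurable
    (measurable_of_countable g).aestronglyMeasurable, PMF.integral_eq_sum]
  simp [PMF.uniformOfFinset_apply, apply_ite ENNReal.toReal, ite_mul, Finset.mul_sum,
    div_eq_inv_mul]

/-- One round of the algorithm: a random vertex and a random edge are sampled, and three degrees are
read off. -/
def degreeRound : QueryTree DegreeSample 5 :=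
  .query .randVert fun x : ℕ =>
  .query (.degree x) fun a : Option ℕ =>
  .query .randEdge fun e : Sym2 ℕ =>
  .query (.degree (Quot.out e).1) fun b : Option ℕ =>
  .last (.degree (Quot.out e).2) fun c : Option ℕ => (a.getD 0, b.getD 0, c.getD 0)

lemma degreeRound_inBaseModel : degreeRound.InBaseModel ∅ := by
  refine ⟨⟨trivial, subset_rfl⟩, fun x => ⟨⟨trivial, Finset.subset_union_right⟩, fun _ =>
    ⟨⟨trivial, Finset.empty_subset _⟩, fun e => ⟨⟨trivial, ?_⟩, fun _ => ⟨trivial, ?_⟩⟩⟩⟩⟩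
  · exact Finset.singleton_subset_iff.2
      (Finset.mem_union_right _ (Sym2.mem_toFinset.2 (Sym2.out_fst_mem e)))
  · exact Finset.singleton_subset_iff.2
      (Finset.mem_union_left _ (Finset.mem_union_right _
        (Sym2.mem_toFinset.2 (Sym2.out_snd_mem e))))

namespace InputGraph

variable (G : InputGraph)

instance : DecidableRel G.graph.Adj := Classical.decRel _

/-- The degree of the vertex with identifier `x`, or `0` if there is no such vertex. -/
def degreeOfId (x : ℕ) : ℕ := ((G.vertex x).map fun v => G.graph.degree v).getD 0

@[simp]
lemma vertex_id (v : Fin G.n) : G.vertex (G.id v) = some v :=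
  Function.partialInv_left G.id.injective v

@[simp]
lemma degreeOfId_id (v : Fin G.n) : G.degreeOfId (G.id v) = G.graph.degree v := by
  simp [degreeOfId]

lemma degreeRound_eval : degreeRound.eval G =
    (PMF.uniformOfFintype (Fin G.n)).bind fun v =>
      (PMF.uniformOfFinset G.graph.edgeFinset G.edgeFinset_nonempty).map fun e =>
        (G.graph.degree v, G.degreeOfId (Quot.out (e.map G.id)).1,
          G.degreeOfId (Quot.out (e.map G.id)).2) := by
  refine (PMF.bind_map _ _ _).trans (congr_arg _ (funext fun v => ?_))
  refine (PMF.pure_bind _ _).trans ((PMF.bind_map _ _ _).trans ?_)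
  rw [← PMF.bind_pure_comp]
  refine congr_arg _ (funext fun e => (PMF.pure_bind _ _).trans ((PMF.pure_map _ _).trans ?_))
  rw [← degreeOfId_id]
  rfl

lemma map_fst_degreeRound_eval : (degreeRound.eval G).map Prod.fst =
    (PMF.uniformOfFinset Finset.univ Finset.univ_nonempty).map fun v => G.graph.degree v := by
  simp only [degreeRound_eval, PMF.map_bind, PMF.map_comp]
  rw [← PMF.bind_pure_comp]
  exact congr_arg _ (funext fun v => PMF.map_const _ _)

lemma map_snd_degreeRound_eval : (degreeRound.eval G).map Prod.snd =
    (PMF.uniformOfFinset G.graph.edgeFinset G.edgeFinset_nonempty).map fun e =>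
      (G.degreeOfId (Quot.out (e.map G.id)).1, G.degreeOfId (Quot.out (e.map G.id)).2) := by
  simp only [degreeRound_eval, PMF.map_bind, PMF.map_comp, Function.comp_def, PMF.bind_const]

lemma degree_pos (v : Fin G.n) : 0 < G.graph.degree v :=
  (G.graph.degree_pos_iff_exists_adj v).2 (G.no_isolated v)

lemma avgDeg_eq : G.avgDeg = 2 * G.graph.edgeFinset.card / G.n := rfl

lemma sum_degree : ∑ v, (G.graph.degree v : ℝ) = 2 * G.graph.edgeFinset.card := by
  exact_mod_cast G.graph.sum_degrees_eq_twice_card_edges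

lemma card_edge_pos : (0 : ℝ) < G.graph.edgeFinset.card :=
  Nat.cast_pos.2 G.edgeFinset_nonempty.card_pos

lemma n_cast_pos : (0 : ℝ) < G.n := Nat.cast_pos.2 G.n_pos

lemma avgDeg_mul_n : G.avgDeg * G.n = 2 * G.graph.edgeFinset.card := by
  rw [avgDeg_eq, div_mul_cancel₀ _ G.n_cast_pos.ne']

lemma one_le_avgDeg : 1 ≤ G.avgDeg := by
  refine le_of_mul_le_mul_right ?_ G.n_cast_pos
  rw [one_mul, avgDeg_mul_n, ← sum_degree]
  calc (G.n : ℝ) = ∑ _v : Fin G.n, (1 : ℝ) := by simp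
    _ ≤ _ := Finset.sum_le_sum fun v _ => by exact_mod_cast G.degree_pos v

lemma avgDeg_le_n : G.avgDeg ≤ G.n := by
  refine le_of_mul_le_mul_right ?_ G.n_cast_pos
  rw [avgDeg_mul_n, ← sum_degree]
  calc _ ≤ ∑ _v : Fin G.n, (G.n : ℝ) := Finset.sum_le_sum fun v _ => by
        exact_mod_cast (G.graph.degree_lt_card_verts v).le.trans_eq (Fintype.card_fin _)
    _ = _ := by simp

/-- The expectation of `vertexStat j`. -/
def vertexMean (j : ℕ) : ℝ := (∑ v, min ((G.graph.degree v : ℝ) / 2 ^ j) 1) / G.n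

/-- The expectation of `edgeStat j`. -/
def edgeMean (j : ℕ) : ℝ :=
  (∑ v, min (G.graph.degree v : ℝ) (2 ^ j)) / (2 * G.graph.edgeFinset.card)

lemma integral_vertexStat (j : ℕ) :
    ∫ o, vertexStat j o ∂(degreeRound.eval G).toMeasure = G.vertexMean j := by
  calc _ = ∫ a, min ((a : ℝ) / 2 ^ j) 1 ∂((degreeRound.eval G).map Prod.fst).toMeasure := by
        rw [← PMF.toMeasure_map _ _ measurable_fst, integral_map measurable_fst.aemeasurable
          (measurable_of_countable _).aestronglyMeasurable]
        rfl
    _ = _ := by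
        rw [map_fst_degreeRound_eval, integral_map_uniformOfFinset, Finset.card_univ,
          Fintype.card_fin, vertexMean]

lemma degree_mul_min_eq (j : ℕ) (v : Fin G.n) :
    (G.graph.degree v : ℝ) * min 1 ((2 : ℝ) ^ j / G.graph.degree v) =
      min (G.graph.degree v : ℝ) (2 ^ j) := by
  have h : (0 : ℝ) < G.graph.degree v := by exact_mod_cast G.degree_pos v
  rw [mul_min_of_nonneg _ _ h.le, mul_one, mul_div_cancel₀ _ h.ne']

lemma add_degreeOfId_out_eq_sum (g : ℕ → ℝ) {e : Sym2 (Fin G.n)} (he : e ∈ G.graph.edgeFinset) :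
    g (G.degreeOfId (Quot.out (e.map G.id)).1) + g (G.degreeOfId (Quot.out (e.map G.id)).2) =
      ∑ v ∈ e.toFinset, g (G.graph.degree v) := by
  induction e using Sym2.ind with
  | _ u w =>
    have hne : u ≠ w := (SimpleGraph.mem_edgeFinset.1 he : G.graph.Adj u w).ne
    have hfin : s(u, w).toFinset = {u, w} := by ext; simp
    have hout : s((Quot.out (Sym2.map G.id s(u, w))).1, (Quot.out (Sym2.map G.id s(u, w))).2) =
        s(G.id u, G.id w) := Quot.out_eq _
    rw [hfin, Finset.sum_pair hne, ← degreeOfId_id, ← degreeOfId_id]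
    rcases Sym2.eq_iff.1 hout with ⟨h1, h2⟩ | ⟨h1, h2⟩
    · rw [h1, h2]
    · rw [h1, h2, add_comm]

lemma sum_edgeFinset_sum_toFinset {V : Type*} [Fintype V] [DecidableEq V] (H : SimpleGraph V)
    [DecidableRel H.Adj] (g : V → ℝ) :
    ∑ e ∈ H.edgeFinset, ∑ v ∈ e.toFinset, g v = ∑ v, H.degree v * g v := by
  rw [Finset.sum_comm' (s' := fun v => H.incidenceFinset v) (t' := Finset.univ)]
  · simp
  · simp [SimpleGraph.incidenceSet]

lemma integral_edgeStat (j : ℕ) :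
    ∫ o, edgeStat j o ∂(degreeRound.eval G).toMeasure = G.edgeMean j := by
  let w : ℕ → ℝ := fun a => min 1 ((2 : ℝ) ^ j / a)
  calc _ = ∫ b : ℕ × ℕ, (w b.1 + w b.2) / 2 ∂((degreeRound.eval G).map Prod.snd).toMeasure := by
        rw [← PMF.toMeasure_map _ _ measurable_snd, integral_map measurable_snd.aemeasurable
          (measurable_of_countable _).aestronglyMeasurable]
        rfl
    _ = (∑ e ∈ G.graph.edgeFinset, ∑ v ∈ e.toFinset, w (G.graph.degree v)) /
          (2 * G.graph.edgeFinset.card) := by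
        rw [map_snd_degreeRound_eval, integral_map_uniformOfFinset, ← Finset.sum_div, div_div,
          Finset.sum_congr rfl fun e he => G.add_degreeOfId_out_eq_sum w he]
    _ = _ := by
        rw [sum_edgeFinset_sum_toFinset, edgeMean]
        simp only [w, degree_mul_min_eq]

end InputGraph

end DegreeRound

section UpperBound

lemma card_edgeFinset_le_sum_min_degree {V : Type*} [Fintype V] (H : SimpleGraph V)
    [DecidableRel H.Adj] {τ : ℝ} (hτ : 0 < τ)
    (hm : 2 * (H.edgeFinset.card : ℝ) ≤ τ ^ 2) :
    (H.edgeFinset.card : ℝ) ≤ ∑ v, min (H.degree v : ℝ) τ := by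
  classical
  have hdegrees : ∑ v, (H.degree v : ℝ) = 2 * H.edgeFinset.card := by
    exact_mod_cast H.sum_degrees_eq_twice_card_edges
  set heavy := Finset.univ.filter fun v => τ < H.degree v with hheavy
  have hlt : ∀ v ∈ heavy, τ < H.degree v := fun v hv => (Finset.mem_filter.1 hv).2
  have hlight : ∑ v ∈ heavyᶜ, min (H.degree v : ℝ) τ = ∑ v ∈ heavyᶜ, (H.degree v : ℝ) :=
    Finset.sum_congr rfl fun v hv => min_eq_left (by simpa [hheavy] using hv)
  have hcard : (heavy.card : ℝ) ≤ τ := by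
    refine le_of_mul_le_mul_right ?_ hτ
    calc heavy.card * τ = ∑ _v ∈ heavy, τ := by simp
      _ ≤ ∑ v ∈ heavy, (H.degree v : ℝ) := Finset.sum_le_sum fun v hv => (hlt v hv).le
      _ ≤ ∑ v, (H.degree v : ℝ) := Finset.sum_le_univ_sum_of_nonneg fun v => Nat.cast_nonneg _
      _ ≤ τ * τ := by rw [hdegrees, ← sq]; exact hm
  have hneighbors : ∀ v ∈ heavy, (H.degree v : ℝ) ≤
      min (H.degree v : ℝ) τ + (heavyᶜ.filter (H.Adj v)).card := fun v hv => by
    have hsub : H.neighborFinset v ⊆ heavy ∪ heavyᶜ.filter (H.Adj v) := fun u hu => by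
      by_cases h : u ∈ heavy <;> simp_all
    have h : (H.degree v : ℝ) ≤ heavy.card + (heavyᶜ.filter (H.Adj v)).card := by
      exact_mod_cast (Finset.card_le_card hsub).trans (Finset.card_union_le _ _)
    rw [min_eq_right (hlt v hv).le]
    linarith
  have hcross : ∑ v ∈ heavy, ((heavyᶜ.filter (H.Adj v)).card : ℝ) ≤
      ∑ u ∈ heavyᶜ, (H.degree u : ℝ) := by
    have hswap := Finset.sum_card_bipartiteAbove_eq_sum_card_bipartiteBelow H.Adj
      (s := heavy) (t := heavyᶜ)
    exact_mod_cast hswap.trans_le (Finset.sum_le_sum fun u _ => Finset.card_le_card fun v hv => by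
      simpa [H.adj_comm] using (Finset.mem_filter.1 hv).2)
  have hsum := (Finset.sum_le_sum hneighbors).trans_eq Finset.sum_add_distrib
  rw [← Finset.sum_add_sum_compl heavy] at hdegrees ⊢
  linarith [Finset.sum_nonneg fun v (_ : v ∈ heavy) => le_min (H.degree v).cast_nonneg hτ.le]

lemma succ_mul_succ_le_of_two_pow_le {x : ℝ} {j : ℕ} (hj : 2 ^ j ≤ x) :
    (((j + 1 : ℕ) : ℝ) + 1) * ((j + 1 : ℕ) + 2) ≤ 9 * (1 + Real.log x) ^ 2 := by
  have hlog := Real.log_le_log (by positivity) hj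
  rw [Real.log_pow] at hlog
  have hjlog : (j : ℝ) ≤ 3 / 2 * Real.log x := by
    nlinarith [Real.log_two_gt_d9, (j.cast_nonneg : (0 : ℝ) ≤ j)]
  push_cast
  nlinarith [(j.cast_nonneg : (0 : ℝ) ≤ j)]

lemma min_sqrt_div_le_rpow {n d : ℝ} (hn : 0 < n) (hd : 0 < d) :
    min d √(n / d) ≤ n ^ (1 / 3 : ℝ) := by
  rcases le_total d (n ^ (1 / 3 : ℝ)) with h | h
  · exact (min_le_left _ _).trans h
  · refine (min_le_right _ _).trans ((Real.sqrt_le_left (by positivity)).2 ?_)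
    rw [div_le_iff₀ hd, ← Real.rpow_natCast, ← Real.rpow_mul hn.le]
    calc n = n ^ (1 / 3 * ((2 : ℕ) : ℝ)) * n ^ (1 / 3 : ℝ) := by
          rw [← Real.rpow_add hn]
          norm_num
      _ ≤ _ := by gcongr

namespace InputGraph

variable (G : InputGraph)

lemma vertexMean_mem_Ioc (j : ℕ) : G.vertexMean j ∈ Set.Ioc 0 1 := by
  refine ⟨div_pos (Finset.sum_pos (fun v _ => ?_) Finset.univ_nonempty) G.n_cast_pos, ?_⟩
  · exact lt_min (div_pos (by exact_mod_cast G.degree_pos v) (by positivity)) one_pos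
  · rw [vertexMean, div_le_one G.n_cast_pos]
    calc _ ≤ ∑ _v : Fin G.n, (1 : ℝ) := Finset.sum_le_sum fun v _ => min_le_right _ _
      _ = G.n := by simp

lemma edgeMean_mem_Ioc (j : ℕ) : G.edgeMean j ∈ Set.Ioc 0 1 := by
  have hm := mul_pos two_pos G.card_edge_pos
  refine ⟨div_pos (Finset.sum_pos (fun v _ => ?_) Finset.univ_nonempty) hm, ?_⟩
  · exact lt_min (by exact_mod_cast G.degree_pos v) (by positivity)
  · rw [edgeMean, div_le_one hm, ← sum_degree]
    exact Finset.sum_le_sum fun v _ => min_le_left _ _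

lemma avgDeg_mul_edgeMean (j : ℕ) : G.avgDeg * G.edgeMean j = 2 ^ j * G.vertexMean j := by
  have hscale : ∀ v, min (G.graph.degree v : ℝ) (2 ^ j) =
      2 ^ j * min ((G.graph.degree v : ℝ) / 2 ^ j) 1 := fun v => by
    rw [mul_min_of_nonneg _ _ (by positivity), mul_one, mul_div_cancel₀ _ (by positivity)]
  rw [edgeMean, Finset.sum_congr rfl fun v _ => hscale v, ← Finset.mul_sum, ← avgDeg_mul_n,
    vertexMean]
  have := G.n_cast_pos
  have := zero_lt_one.trans_le G.one_le_avgDeg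
  field_simp

lemma vertexMean_zero : G.vertexMean 0 = 1 := by
  have hone : ∀ v, min ((G.graph.degree v : ℝ) / 2 ^ 0) 1 = 1 := fun v =>
    min_eq_right (by rw [pow_zero, div_one]; exact_mod_cast G.degree_pos v)
  rw [vertexMean, Finset.sum_congr rfl fun v _ => hone v]
  simp [G.n_pos.ne']

lemma half_le_edgeMean {j : ℕ} (hj : G.avgDeg * G.n ≤ 4 ^ j) : 1 / 2 ≤ G.edgeMean j := by
  have hm : 2 * (G.graph.edgeFinset.card : ℝ) ≤ (2 ^ j) ^ 2 := by
    rwa [← avgDeg_mul_n, ← pow_mul, mul_comm j, pow_mul, show (2 : ℝ) ^ 2 = 4 by norm_num]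
  have h := card_edgeFinset_le_sum_min_degree G.graph (by positivity) hm
  rw [edgeMean, le_div_iff₀ (mul_pos two_pos G.card_edge_pos)]
  linarith

lemma one_le_sqrt_n_div_avgDeg : 1 ≤ √(G.n / G.avgDeg) := by
  rw [Real.one_le_sqrt, one_le_div (zero_lt_one.trans_le G.one_le_avgDeg)]
  exact G.avgDeg_le_n

lemma one_le_four_mul_sqrt_mul_vertexMean {j : ℕ} (hj : (4 : ℝ) ^ j ≤ G.avgDeg * G.n)
    (hβ : 1 / 2 ≤ G.edgeMean (j + 1)) : 1 ≤ 4 * √(G.n / G.avgDeg) * G.vertexMean (j + 1) := by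
  have hd := zero_lt_one.trans_le G.one_le_avgDeg
  have htwo : (2 : ℝ) ^ j ≤ G.avgDeg * √(G.n / G.avgDeg) := by
    refine le_of_sq_le_sq ?_ (by positivity)
    rw [mul_pow, Real.sq_sqrt (div_nonneg G.n_cast_pos.le hd.le), ← pow_mul, mul_comm j, pow_mul]
    refine le_trans (by norm_num [hj]) (hj.trans_eq ?_)
    field_simp
  refine le_of_mul_le_mul_left ?_ hd
  calc G.avgDeg * 1 ≤ 2 * (G.avgDeg * G.edgeMean (j + 1)) := by nlinarith
    _ = 2 ^ j * (4 * G.vertexMean (j + 1)) := by rw [avgDeg_mul_edgeMean]; ring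
    _ ≤ G.avgDeg * √(G.n / G.avgDeg) * (4 * G.vertexMean (j + 1)) := by
        gcongr; linarith [(G.vertexMean_mem_Ioc (j + 1)).1]
    _ = _ := by ring

-- The scale `1` has means `1` and `1 / d`; a scale of order `√(2m)` has means of order `√(d / n)`
-- and `1`.
lemma exists_scale : ∃ j : ℕ, ((j : ℝ) + 1) * (j + 2) ≤ 9 * (1 + Real.log G.n) ^ 2 ∧
    1 ≤ 4 * min G.avgDeg √(G.n / G.avgDeg) * G.vertexMean j ∧
    1 ≤ 4 * min G.avgDeg √(G.n / G.avgDeg) * G.edgeMean j := by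
  have hd := G.one_le_avgDeg
  rcases le_total G.avgDeg √(G.n / G.avgDeg) with hmin | hmin
  · have hα := G.vertexMean_zero
    have hβ := G.avgDeg_mul_edgeMean 0
    have hlog : 0 ≤ Real.log G.n := Real.log_nonneg (Nat.one_le_cast.2 G.n_pos)
    rw [hα, pow_zero] at hβ
    rw [min_eq_left hmin]
    exact ⟨0, by push_cast; nlinarith, by rw [hα]; linarith, by linarith⟩
  · rw [min_eq_right hmin]
    obtain ⟨j, hj, hj'⟩ := exists_nat_pow_near (y := (4 : ℝ))
      (one_le_mul_of_one_le_of_one_le hd (Nat.one_le_cast.2 G.n_pos)) (by norm_num)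
    have hβ := G.half_le_edgeMean hj'.le
    refine ⟨j + 1, succ_mul_succ_le_of_two_pow_le ?_, G.one_le_four_mul_sqrt_mul_vertexMean hj hβ,
      by nlinarith [G.one_le_sqrt_n_div_avgDeg]⟩
    refine le_of_sq_le_sq ?_ G.n_cast_pos.le
    calc ((2 : ℝ) ^ j) ^ 2 = 4 ^ j := by rw [← pow_mul, mul_comm j, pow_mul]; norm_num
      _ ≤ G.n * G.n := hj.trans (by gcongr; exact G.avgDeg_le_n)
      _ = _ := (sq _).symm

end InputGraph

namespace QueryAlgorithm

variable (A : QueryAlgorithm) (G : InputGraph) (S : Set ℝ)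

lemma runFrom_mono (k : ℕ) (s : A.State) : (A.runFrom G k s).toOuterMeasure (some '' S) ≤
    (A.runFrom G (k + 1) s).toOuterMeasure (some '' S) := by
  induction k generalizing s with
  | zero =>
    cases hnext : A.next s with
    | inl qf => simp [runFrom, hnext, PMF.toOuterMeasure_pure_apply]
    | inr x => simp [runFrom, hnext]
  | succ k ih =>
    cases hnext : A.next s with
    | inl qf =>
      rw [runFrom, runFrom]
      simp only [hnext, PMF.toOuterMeasure_bind_apply]
      exact ENNReal.tsum_le_tsum fun r => mul_le_mul_right (ENNReal.tsum_le_tsum fun s' =>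
        mul_le_mul_right (ih s') _) _
    | inr x => simp [runFrom, hnext]

lemma probWithin_mono : Monotone fun k => A.probWithin G k S := by
  refine monotone_nat_of_le_succ fun k => ?_
  simp only [probWithin, PMF.toOuterMeasure_bind_apply]
  exact ENNReal.tsum_le_tsum fun s => mul_le_mul_right (A.runFrom_mono G S k s) _

end QueryAlgorithm

variable {ε : ℝ}

/-- The algorithm that samples the degrees of random vertices and of the endpoints of random edges
until `stoppingRule ε` yields an estimate. -/
def degreeEstimator (ε : ℝ) : QueryAlgorithm := sampleUntil degreeRound (stoppingRule ε)

lemma lt_probWithin_degreeEstimator (G : InputGraph) (hε0 : 0 < ε) (hε1 : ε < 1) {k j : ℕ} {Y : ℝ}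
    (hα : 1 ≤ Y * G.vertexMean j) (hβ : 1 ≤ Y * G.edgeMean j)
    (hk : 10 * threshold ε j * Y ≤ k) :
    99 / 100 < (degreeEstimator ε).probWithin G k {x | |x - G.avgDeg| ≤ ε * G.avgDeg} := by
  have hU := threshold_pos hε0 j
  have hT : threshold ε j * (1 + ε / 8) * Y ≤ (k / 5 : ℕ) := by
    have hY : 1 ≤ Y := by nlinarith [(G.vertexMean_mem_Ioc j).1, (G.vertexMean_mem_Ioc j).2]
    have hfloor : (k : ℝ) ≤ 5 * (k / 5 : ℕ) + 5 := by
      exact_mod_cast (by omega : k ≤ 5 * (k / 5) + 5)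
    nlinarith [one_le_threshold_mul hε0 hε1 j, mul_le_mul_of_nonneg_left hY hU.le]
  have htime : ∀ μ ∈ Set.Ioc (0 : ℝ) 1, 1 ≤ Y * μ →
      threshold ε j * (1 + ε / 8) / μ ≤ (k / 5 : ℕ) := fun μ hμ h => by
    refine le_trans ?_ hT
    rw [div_le_iff₀ hμ.1, mul_assoc _ Y]
    exact le_mul_of_one_le_right (by positivity) h
  have hstops := lt_infinitePi_stopsIn (degreeRound.eval G).toMeasure hε0 hε1
    (zero_lt_one.trans_le G.one_le_avgDeg) (T := k / 5) (j := j)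
    (fun j => by rw [G.integral_vertexStat]; exact G.vertexMean_mem_Ioc j)
    (fun j => by rw [G.integral_edgeStat]; exact G.edgeMean_mem_Ioc j)
    (fun j => by rw [G.integral_vertexStat, G.integral_edgeStat, G.avgDeg_mul_edgeMean])
    (by rw [G.integral_vertexStat]; exact htime _ (G.vertexMean_mem_Ioc j) hα)
    (by rw [G.integral_edgeStat]; exact htime _ (G.edgeMean_mem_Ioc j) hβ)
  exact hstops.trans_le ((infinitePi_stopsIn_le G _ _).trans
    ((degreeEstimator ε).probWithin_mono G _ (Nat.mul_div_le k 5)))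

lemma ten_mul_threshold_mul_le_floor (hε0 : 0 < ε) (hε1 : ε < 1) {j : ℕ} {L X : ℝ} (hL : 1 ≤ L)
    (hX : 1 ≤ X) (hj : ((j : ℝ) + 1) * (j + 2) ≤ 9 * L ^ 2) :
    10 * threshold ε j * (4 * X) ≤ ⌊10 ^ 8 * L ^ 2 * (ε⁻¹ ^ 2 * X)⌋₊ := by
  have hεX : 1 ≤ ε⁻¹ ^ 2 * X :=
    one_le_mul_of_one_le_of_one_le (one_le_pow₀ ((one_le_inv₀ hε0).2 hε1.le)) hX
  have hthreshold : threshold ε j = 102400 * ((j + 1) * (j + 2)) * ε⁻¹ ^ 2 := by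
    rw [threshold, div_eq_mul_inv, inv_pow]
  refine le_trans ?_ (Nat.sub_one_lt_floor _).le
  rw [hthreshold]
  nlinarith [mul_le_mul_of_nonneg_right hj (zero_le_one.trans hεX),
    one_le_mul_of_one_le_of_one_le (one_le_pow₀ hL (n := 2)) hεX]

theorem exists_queryAlgorithm_lt_probWithin :
    ∃ (C : ℝ) (p : ℕ), 0 < C ∧ ∀ ε : ℝ, 0 < ε → ε < 1 →
      ∃ A : QueryAlgorithm, A.InBaseModelWithRandEdge ∧ ∀ G : InputGraph,
        99 / 100 < A.probWithin G
            ⌊C * (1 + Real.log G.n) ^ p *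
              (ε⁻¹ ^ 2 * min G.avgDeg (Real.sqrt (G.n / G.avgDeg)))⌋₊
            {x | |x - G.avgDeg| ≤ ε * G.avgDeg} ∧
        99 / 100 < A.probWithin G
            ⌊C * (1 + Real.log G.n) ^ p * (ε⁻¹ ^ 2 * (G.n : ℝ) ^ (1 / 3 : ℝ))⌋₊
            {x | |x - G.avgDeg| ≤ ε * G.avgDeg} := by
  refine ⟨10 ^ 8, 2, by norm_num, fun ε hε0 hε1 => ⟨degreeEstimator ε,
    sampleUntil_inBaseModelWithRandEdge degreeRound_inBaseModel, fun G => ?_⟩⟩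
  obtain ⟨j, hj, hα, hβ⟩ := G.exists_scale
  have hlog : 0 ≤ Real.log G.n := Real.log_nonneg (Nat.one_le_cast.2 G.n_pos)
  have hmin := lt_probWithin_degreeEstimator G hε0 hε1 hα hβ
    (ten_mul_threshold_mul_le_floor hε0 hε1 (by linarith)
      (le_min G.one_le_avgDeg G.one_le_sqrt_n_div_avgDeg) hj)
  refine ⟨hmin, hmin.trans_le ((degreeEstimator ε).probWithin_mono G _ ?_)⟩
  gcongr
  exact min_sqrt_div_le_rpow G.n_cast_pos (zero_lt_one.trans_le G.one_le_avgDeg)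

end UpperBound

/-! ### Indistinguishable inputs -/

section LowerBound

lemma uniformOfFinset_map_embedding {α β : Type*} (s : Finset α) (hs : s.Nonempty) (f : α ↪ β) :
    (PMF.uniformOfFinset s hs).map f = PMF.uniformOfFinset (s.map f) hs.map := by
  classical
  ext b
  rw [PMF.map_apply]
  by_cases hb : b ∈ s.map f
  · obtain ⟨a, ha, rfl⟩ := Finset.mem_map.1 hb
    rw [tsum_eq_single a fun a' ha' => if_neg fun h => ha' (f.injective h).symm, if_pos rfl,
      PMF.uniformOfFinset_apply_of_mem _ ha, PMF.uniformOfFinset_apply_of_mem _ hb,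
      Finset.card_map]
  · rw [PMF.uniformOfFinset_apply_of_notMem _ hb, ENNReal.tsum_eq_zero]
    rintro a
    split_ifs with hab
    · exact PMF.uniformOfFinset_apply_of_notMem _ fun ha =>
        hb (Finset.mem_map.2 ⟨a, ha, hab.symm⟩)
    · rfl

lemma toOuterMeasure_le_one {α : Type*} (p : PMF α) (X : Set α) : p.toOuterMeasure X ≤ 1 :=
  (p.toOuterMeasure.mono X.subset_univ).trans_eq
    ((p.toOuterMeasure_apply_eq_one_iff Set.univ).2 (Set.subset_univ _))

lemma toOuterMeasure_union {α : Type*} (p : PMF α) {X Y : Set α} (h : Disjoint X Y) :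
    p.toOuterMeasure (X ∪ Y) = p.toOuterMeasure X + p.toOuterMeasure Y := by
  simp only [PMF.toOuterMeasure_apply, Set.indicator_union_of_disjoint h, ENNReal.tsum_add]

lemma toOuterMeasure_add_compl {α : Type*} (p : PMF α) (X : Set α) :
    p.toOuterMeasure X + p.toOuterMeasure Xᶜ = 1 := by
  rw [← toOuterMeasure_union p disjoint_compl_right, Set.union_compl_self]
  exact (p.toOuterMeasure_apply_eq_one_iff _).2 (Set.subset_univ _)

lemma toOuterMeasure_bind_add_le {α β : Type*} (p : PMF α) {f g h : α → PMF β} {X Y Z : Set β}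
    (H : ∀ a, (f a).toOuterMeasure X + (g a).toOuterMeasure Y ≤ 1 + (h a).toOuterMeasure Z) :
    (p.bind f).toOuterMeasure X + (p.bind g).toOuterMeasure Y ≤
      1 + (p.bind h).toOuterMeasure Z := by
  simp only [PMF.toOuterMeasure_bind_apply]
  rw [← p.tsum_coe, ← ENNReal.tsum_add, ← ENNReal.tsum_add]
  refine ENNReal.tsum_le_tsum fun a => ?_
  calc _ = p a * ((f a).toOuterMeasure X + (g a).toOuterMeasure Y) := (mul_add _ _ _).symm
    _ ≤ p a * (1 + (h a).toOuterMeasure Z) := mul_le_mul_right (H a) _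
    _ = _ := by rw [mul_add, mul_one]

lemma mul_toOuterMeasure_bind_le_sum {α β ι : Type*} {p : PMF α} {s : Finset ι} {a : ℝ≥0∞}
    {X : Set β} {q : α → PMF β} {p' : ι → PMF α} {q' : ι → α → PMF β}
    (H : ∀ x ∈ p.support, a * p x * (q x).toOuterMeasure X ≤
      ∑ i ∈ s, p' i x * (q' i x).toOuterMeasure X) :
    a * (p.bind q).toOuterMeasure X ≤ ∑ i ∈ s, ((p' i).bind (q' i)).toOuterMeasure X := by
  simp only [PMF.toOuterMeasure_bind_apply]
  rw [← ENNReal.tsum_mul_left, ← Summable.tsum_finsetSum fun _ _ => ENNReal.summable]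
  refine ENNReal.tsum_le_tsum fun x => ?_
  rw [← mul_assoc]
  by_cases hx : x ∈ p.support
  · exact H x hx
  · rw [(p.apply_eq_zero_iff x).2 hx, mul_zero, zero_mul]
    exact zero_le

namespace QueryAlgorithm

variable (A : QueryAlgorithm) (G : InputGraph) {S S' : Set ℝ}

lemma runFrom_add_runFrom_le (S : Set ℝ) (k k' : ℕ) (s : A.State) :
    (A.runFrom G k' s).toOuterMeasure (some '' S) +
      (A.runFrom G k s).toOuterMeasure (some '' Set.univ) ≤
      1 + (A.runFrom G k s).toOuterMeasure (some '' S) := by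
  cases hnext : A.next s with
  | inr x =>
    have hrun (k : ℕ) : A.runFrom G k s = PMF.pure (some x) := by cases k <;> simp [runFrom, hnext]
    rw [hrun, hrun, add_comm]
    gcongr
    exact toOuterMeasure_le_one _ _
  | inl qf =>
    have hzero (T : Set ℝ) : (A.runFrom G 0 s).toOuterMeasure (some '' T) = 0 := by
      simp [runFrom, hnext, PMF.toOuterMeasure_pure_apply]
    match k, k' with
    | 0, _ =>
      rw [hzero, hzero, add_zero, add_zero]
      exact toOuterMeasure_le_one _ _
    | _ + 1, 0 =>
      rw [hzero, zero_add]
      exact (toOuterMeasure_le_one _ _).trans le_self_add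
    | k + 1, k' + 1 =>
      rw [runFrom, runFrom]
      simp only [hnext]
      exact toOuterMeasure_bind_add_le _ fun r => toOuterMeasure_bind_add_le _ fun s' =>
        runFrom_add_runFrom_le S k k' s'

lemma prob_add_probWithin_le (S : Set ℝ) (k : ℕ) :
    A.prob G S + A.probWithin G k Set.univ ≤ 1 + A.probWithin G k S := by
  rw [prob, ENNReal.iSup_add]
  exact iSup_le fun k' => toOuterMeasure_bind_add_le _ fun s => A.runFrom_add_runFrom_le G S k k' s

lemma probWithin_add_prob_le (h : Disjoint S S') (k : ℕ) :
    A.probWithin G k S + A.prob G S' ≤ 1 := by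
  have hadd : A.probWithin G k S + A.probWithin G k S' ≤ A.probWithin G k Set.univ := by
    rw [probWithin, probWithin, ← toOuterMeasure_union _
      ((Set.disjoint_image_iff (Option.some_injective _)).2 h), ← Set.image_union]
    exact MeasureTheory.measure_mono (Set.image_mono (Set.subset_univ _))
  have hfin : A.probWithin G k S' ≠ ⊤ :=
    ((toOuterMeasure_le_one _ _).trans_lt ENNReal.one_lt_top).ne
  refine (ENNReal.add_le_add_iff_right hfin).1 (le_trans ?_ (A.prob_add_probWithin_le G S' k))
  calc _ = A.prob G S' + (A.probWithin G k S + A.probWithin G k S') := by ring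
    _ ≤ _ := by gcongr

end QueryAlgorithm

namespace InputGraph

variable {G G' : InputGraph}

/-- The identifiers of the vertices of `G`. -/
def idFinset (G : InputGraph) : Finset ℕ := Finset.univ.map G.id

lemma mem_idFinset {x : ℕ} : x ∈ G.idFinset ↔ ∃ v, G.id v = x := by simp [idFinset]

lemma card_idFinset (G : InputGraph) : G.idFinset.card = G.n := by simp [idFinset]

lemma vertex_eq_none {x : ℕ} (hx : x ∉ G.idFinset) : G.vertex x = none := by
  rw [vertex, Function.partialInv, dif_neg (mt mem_idFinset.2 hx)]

/-- The identifiers of the neighbors of the vertex with identifier `x`, or `none` if there is no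
such vertex. -/
def nbrIds (G : InputGraph) (x : ℕ) : Option (Finset ℕ) :=
  (G.vertex x).map fun v => (G.graph.neighborFinset v).map G.id

lemma answer_randNbr_congr {x : ℕ} (h : G.nbrIds x = G'.nbrIds x) :
    G.answer (.randNbr x) = G'.answer (.randNbr x) := by
  have hrun {H : InputGraph} {v : Fin H.n} (hv : H.vertex x = some v) : H.answer (.randNbr x) =
      (PMF.uniformOfFinset _ ((H.neighborFinset_nonempty v).map (f := H.id))).map some := by
    rw [← uniformOfFinset_map_embedding _ (H.neighborFinset_nonempty v), PMF.map_comp]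
    simp only [answer, hv]
    rfl
  unfold nbrIds at h
  cases hv : G.vertex x <;> cases hv' : G'.vertex x <;> rw [hv, hv'] at h
  · simp only [answer, hv, hv']
  · simp at h
  · simp at h
  · refine (hrun hv).trans (Eq.trans ?_ (hrun hv').symm)
    congr 2
    exact Option.some.inj h

lemma answer_degree_congr {x : ℕ} (h : G.nbrIds x = G'.nbrIds x) :
    G.answer (.degree x) = G'.answer (.degree x) := by
  have hdeg (H : InputGraph) :
      H.answer (.degree x) = PMF.pure ((H.nbrIds x).map Finset.card) := by
    simp only [answer, nbrIds, Option.map_map, Function.comp_def, Finset.card_map,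
      SimpleGraph.card_neighborFinset_eq_degree]
    rfl
  exact (hdeg G).trans ((congr_arg _ (congr_arg _ h)).trans (hdeg G').symm)

lemma answer_fullNbrHood_congr {x : ℕ} (h : G.nbrIds x = G'.nbrIds x) :
    G.answer (.fullNbrHood x) = G'.answer (.fullNbrHood x) :=
  congr_arg PMF.pure h

lemma answer_randVert_apply {x : ℕ} (hx : x ∈ G.idFinset) :
    G.answer .randVert x = (G.n : ℝ≥0∞)⁻¹ := by
  rw [← G.card_idFinset]
  exact (DFunLike.congr_fun (uniformOfFinset_map_embedding Finset.univ Finset.univ_nonempty G.id)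
    x).trans (PMF.uniformOfFinset_apply_of_mem _ hx)

/-- The edges of `G` in terms of identifiers. -/
def idEdgeFinset (G : InputGraph) : Finset (Sym2 ℕ) := G.graph.edgeFinset.map G.id.sym2Map

lemma answer_randEdge_apply {e : Sym2 ℕ} (he : e ∈ G.idEdgeFinset) :
    G.answer .randEdge e = (G.graph.edgeFinset.card : ℝ≥0∞)⁻¹ := by
  rw [← Finset.card_map G.id.sym2Map]
  exact (DFunLike.congr_fun (uniformOfFinset_map_embedding _ G.edgeFinset_nonempty G.id.sym2Map)
    e).trans (PMF.uniformOfFinset_apply_of_mem _ he)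

/-- `G` is an induced subgraph of a graph `H` on the universe of identifiers. -/
def InducedFrom (G : InputGraph) (H : SimpleGraph ℕ) : Prop :=
  ∀ u v, G.graph.Adj u v ↔ H.Adj (G.id u) (G.id v)

namespace InducedFrom

variable {H : SimpleGraph ℕ}

lemma map_neighborFinset [DecidableRel H.Adj] (hG : G.InducedFrom H) (v : Fin G.n) :
    (G.graph.neighborFinset v).map G.id = G.idFinset.filter (H.Adj (G.id v)) := by
  ext y
  simp only [Finset.mem_map, SimpleGraph.mem_neighborFinset, Finset.mem_filter, mem_idFinset]
  constructor
  · rintro ⟨w, hw, rfl⟩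
    exact ⟨⟨w, rfl⟩, (hG _ _).1 hw⟩
  · rintro ⟨⟨w, rfl⟩, hw⟩
    exact ⟨w, (hG _ _).2 hw, rfl⟩

lemma nbrIds_eq [DecidableRel H.Adj] (hG : G.InducedFrom H) (x : ℕ) :
    G.nbrIds x = if x ∈ G.idFinset then some (G.idFinset.filter (H.Adj x)) else none := by
  split_ifs with hx
  · obtain ⟨v, rfl⟩ := mem_idFinset.1 hx
    rw [nbrIds, vertex_id, Option.map_some, hG.map_neighborFinset]
  · rw [nbrIds, vertex_eq_none hx, Option.map_none]

lemma nbrIds_congr (hG : G.InducedFrom H) (hG' : G'.InducedFrom H) {x : ℕ}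
    (hx : ∀ y, (y = x ∨ H.Adj x y) → (y ∈ G.idFinset ↔ y ∈ G'.idFinset)) :
    G.nbrIds x = G'.nbrIds x := by
  classical
  have hfilter : G.idFinset.filter (H.Adj x) = G'.idFinset.filter (H.Adj x) := by
    ext y
    simp only [Finset.mem_filter]
    exact and_congr_left fun hy => hx y (Or.inr hy)
  rw [hG.nbrIds_eq, hG'.nbrIds_eq, hfilter]
  simp only [hx x (Or.inl rfl)]

open Classical in
lemma answer_pair (hG : G.InducedFrom H) (x y : ℕ) : G.answer (.pair x y) =
      PMF.pure (decide (x ∈ G.idFinset ∧ y ∈ G.idFinset ∧ H.Adj x y)) := by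
  simp only [answer]
  congr 2
  simp only [mem_idFinset, eq_iff_iff]
  constructor
  · rintro ⟨u, v, rfl, rfl, h⟩
    exact ⟨⟨u, rfl⟩, ⟨v, rfl⟩, (hG _ _).1 h⟩
  · rintro ⟨⟨u, rfl⟩, ⟨v, rfl⟩, h⟩
    exact ⟨u, v, rfl, rfl, (hG _ _).2 h⟩

lemma mk_mem_idEdgeFinset (hG : G.InducedFrom H) {x y : ℕ} (hx : x ∈ G.idFinset)
    (hy : y ∈ G.idFinset) (hxy : H.Adj x y) : s(x, y) ∈ G.idEdgeFinset := by
  obtain ⟨u, rfl⟩ := mem_idFinset.1 hx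
  obtain ⟨v, rfl⟩ := mem_idFinset.1 hy
  exact Finset.mem_map.2 ⟨s(u, v), SimpleGraph.mem_edgeFinset.2 ((hG u v).2 hxy), rfl⟩

lemma two_mul_card_edgeFinset [DecidableRel H.Adj] (hG : G.InducedFrom H) :
    2 * G.graph.edgeFinset.card = ∑ x ∈ G.idFinset, (G.idFinset.filter (H.Adj x)).card := by
  rw [← G.graph.sum_degrees_eq_twice_card_edges]
  conv_rhs => rw [idFinset, Finset.sum_map]
  refine Finset.sum_congr rfl fun v _ => ?_
  rw [← SimpleGraph.card_neighborFinset_eq_degree, ← Finset.card_map G.id, hG.map_neighborFinset]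
  rfl

end InducedFrom

/-- The input graph that `H` induces on a finite set of identifiers. -/
def ofFinset (H : SimpleGraph ℕ) (V : Finset ℕ) (hV : V.Nonempty)
    (hiso : ∀ x ∈ V, ∃ y ∈ V, H.Adj x y) : InputGraph where
  n := V.card
  n_pos := hV.card_pos
  graph := H.comap (V.orderEmbOfFin rfl)
  no_isolated v := by
    obtain ⟨y, hy, hxy⟩ := hiso _ (V.orderEmbOfFin_mem rfl v)
    obtain ⟨w, rfl⟩ : y ∈ Set.range (V.orderEmbOfFin rfl) := by rwa [Finset.range_orderEmbOfFin]
    exact ⟨w, hxy⟩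
  id := (V.orderEmbOfFin rfl).toEmbedding

lemma idFinset_ofFinset (H : SimpleGraph ℕ) (V : Finset ℕ) (hV : V.Nonempty)
    (hiso : ∀ x ∈ V, ∃ y ∈ V, H.Adj x y) : (ofFinset H V hV hiso).idFinset = V := by
  ext x
  rw [mem_idFinset, ← Finset.mem_coe, ← Finset.range_orderEmbOfFin V rfl]
  rfl

lemma inducedFrom_ofFinset (H : SimpleGraph ℕ) (V : Finset ℕ) (hV : V.Nonempty)
    (hiso : ∀ x ∈ V, ∃ y ∈ V, H.Adj x y) : (ofFinset H V hV hiso).InducedFrom H :=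
  fun _ _ => Iff.rfl

end InputGraph

/-! ### A clique and a hidden matching -/

/-- The graph on `ℕ` that consists of a clique on `{0, …, h - 1}` and of the edges between
`h + 2 * i` and `h + 2 * i + 1`. -/
def cliqueMatching (h : ℕ) : SimpleGraph ℕ where
  Adj x y := x ≠ y ∧ ((x < h ∧ y < h) ∨ (h ≤ x ∧ h ≤ y ∧ (x - h) / 2 = (y - h) / 2))
  symm := ⟨fun _ _ hxy => ⟨hxy.1.symm, by have := hxy.2; omega⟩⟩
  loopless := ⟨fun _ hx => hx.1 rfl⟩

/-- The other end of the matching edge of `cliqueMatching h` at `x`, for `h ≤ x`. -/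
def partner (h x : ℕ) : ℕ := if (x - h) % 2 = 0 then x + 1 else x - 1

/-- The ends of the matching edges with index in `I`. -/
def matchingIds (h : ℕ) (I : Finset ℕ) : Finset ℕ := I.biUnion fun i => {h + 2 * i, h + 2 * i + 1}

/-- The vertices of the clique together with the ends of the matching edges with index in `I`. -/
def cliqueMatchingIds (h : ℕ) (I : Finset ℕ) : Finset ℕ := Finset.range h ∪ matchingIds h I

section CliqueMatching

variable {h x y : ℕ} {I I' : Finset ℕ}

instance : DecidableRel (cliqueMatching h).Adj :=
  fun x y => inferInstanceAs (Decidable (x ≠ y ∧ _))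

lemma cliqueMatching_adj : (cliqueMatching h).Adj x y ↔
    x ≠ y ∧ ((x < h ∧ y < h) ∨ (h ≤ x ∧ h ≤ y ∧ (x - h) / 2 = (y - h) / 2)) := Iff.rfl

lemma cliqueMatching_adj_of_lt (hx : x < h) : (cliqueMatching h).Adj x y ↔ y ≠ x ∧ y < h := by
  rw [cliqueMatching_adj]
  omega

lemma cliqueMatching_adj_of_le (hx : h ≤ x) : (cliqueMatching h).Adj x y ↔ y = partner h x := by
  rw [cliqueMatching_adj, partner]
  split_ifs <;> omega

lemma mem_matchingIds : x ∈ matchingIds h I ↔ h ≤ x ∧ (x - h) / 2 ∈ I := by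
  simp only [matchingIds, Finset.mem_biUnion, Finset.mem_insert, Finset.mem_singleton]
  constructor
  · rintro ⟨i, hi, hx⟩
    exact ⟨by omega, by rwa [show (x - h) / 2 = i by omega]⟩
  · rintro ⟨hx, hi⟩
    exact ⟨_, hi, by omega⟩

lemma mem_cliqueMatchingIds : x ∈ cliqueMatchingIds h I ↔ x < h ∨ (h ≤ x ∧ (x - h) / 2 ∈ I) := by
  rw [cliqueMatchingIds, Finset.mem_union, Finset.mem_range, mem_matchingIds]

lemma mem_cliqueMatchingIds_iff_of_adj (hxy : (cliqueMatching h).Adj x y) :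
    y ∈ cliqueMatchingIds h I ↔ x ∈ cliqueMatchingIds h I := by
  rw [cliqueMatching_adj] at hxy
  rw [mem_cliqueMatchingIds, mem_cliqueMatchingIds]
  rcases hxy.2 with ⟨hx, hy⟩ | ⟨hx, hy, heq⟩
  · simp [hx, hy]
  · simp [hx, hy, heq, hx.not_gt, hy.not_gt]

lemma card_matchingIds (h : ℕ) (I : Finset ℕ) : (matchingIds h I).card = 2 * I.card := by
  rw [matchingIds, Finset.card_biUnion]
  · have hpair : ∀ i ∈ I, ({h + 2 * i, h + 2 * i + 1} : Finset ℕ).card = 2 := fun i _ =>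
      Finset.card_pair (by omega)
    rw [Finset.sum_const_nat hpair, mul_comm]
  · intro i _ j _ hij
    simp only [Finset.disjoint_left, Finset.mem_insert, Finset.mem_singleton]
    omega

lemma disjoint_range_matchingIds (h : ℕ) (I : Finset ℕ) :
    Disjoint (Finset.range h) (matchingIds h I) :=
  Finset.disjoint_left.2 fun _ hx hx' =>
    (Finset.mem_range.1 hx).not_ge (mem_matchingIds.1 hx').1

lemma card_filter_adj_of_lt (hx : x < h) (I : Finset ℕ) :
    ((cliqueMatchingIds h I).filter ((cliqueMatching h).Adj x)).card = h - 1 := by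
  have heq : (cliqueMatchingIds h I).filter ((cliqueMatching h).Adj x) =
      (Finset.range h).erase x := by
    ext y
    simp only [Finset.mem_filter, mem_cliqueMatchingIds, cliqueMatching_adj_of_lt hx,
      Finset.mem_erase, Finset.mem_range]
    tauto
  rw [heq, Finset.card_erase_of_mem (Finset.mem_range.2 hx), Finset.card_range]

lemma card_filter_adj_of_le (hx : h ≤ x) (hI : (x - h) / 2 ∈ I) :
    ((cliqueMatchingIds h I).filter ((cliqueMatching h).Adj x)).card = 1 := by
  refine Finset.card_eq_one.2 ⟨partner h x, ?_⟩
  ext y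
  rw [Finset.mem_filter, Finset.mem_singleton, ← cliqueMatching_adj_of_le hx, and_iff_right_iff_imp]
  exact fun hxy => (mem_cliqueMatchingIds_iff_of_adj hxy).2
    (mem_cliqueMatchingIds.2 (Or.inr ⟨hx, hI⟩))

lemma exists_adj_of_mem_cliqueMatchingIds (hh : 2 ≤ h) (hx : x ∈ cliqueMatchingIds h I) :
    ∃ y ∈ cliqueMatchingIds h I, (cliqueMatching h).Adj x y := by
  obtain ⟨y, hxy⟩ : ∃ y, (cliqueMatching h).Adj x y := by
    rcases lt_or_ge x h with hlt | hge
    · exact ⟨if x = 0 then 1 else 0, (cliqueMatching_adj_of_lt hlt).2 (by split_ifs <;> omega)⟩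
    · exact ⟨_, (cliqueMatching_adj_of_le hge).2 rfl⟩
  exact ⟨y, (mem_cliqueMatchingIds_iff_of_adj hxy).2 hx, hxy⟩

variable (hh : 2 ≤ h)

/-- The input graph that consists of a clique on `h` vertices and a matching indexed by `I`. -/
def cliqueMatchingInput (I : Finset ℕ) : InputGraph :=
  InputGraph.ofFinset (cliqueMatching h) (cliqueMatchingIds h I)
    ⟨0, mem_cliqueMatchingIds.2 (Or.inl (by omega))⟩
    fun _ => exists_adj_of_mem_cliqueMatchingIds hh

lemma idFinset_cliqueMatchingInput (I : Finset ℕ) :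
    (cliqueMatchingInput hh I).idFinset = cliqueMatchingIds h I :=
  InputGraph.idFinset_ofFinset _ _ _ _

lemma inducedFrom_cliqueMatchingInput (I : Finset ℕ) :
    (cliqueMatchingInput hh I).InducedFrom (cliqueMatching h) :=
  InputGraph.inducedFrom_ofFinset _ _ _ _

lemma n_cliqueMatchingInput (I : Finset ℕ) : (cliqueMatchingInput hh I).n = h + 2 * I.card := by
  rw [← InputGraph.card_idFinset, idFinset_cliqueMatchingInput, cliqueMatchingIds,
    Finset.card_union_of_disjoint (disjoint_range_matchingIds h I), Finset.card_range,
    card_matchingIds]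

lemma card_edgeFinset_cliqueMatchingInput (I : Finset ℕ) :
    (cliqueMatchingInput hh I).graph.edgeFinset.card = h.choose 2 + I.card := by
  have htwo : 2 * h.choose 2 = h * (h - 1) := by
    rw [Nat.choose_two_right, Nat.mul_div_cancel' (Nat.even_mul_pred_self h).two_dvd]
  refine Nat.eq_of_mul_eq_mul_left two_pos ?_
  rw [(inducedFrom_cliqueMatchingInput hh I).two_mul_card_edgeFinset, idFinset_cliqueMatchingInput,
    cliqueMatchingIds, Finset.sum_union (disjoint_range_matchingIds h I), ← cliqueMatchingIds,
    Finset.sum_congr rfl fun x hx => card_filter_adj_of_lt (Finset.mem_range.1 hx) I,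
    Finset.sum_congr rfl fun x hx => card_filter_adj_of_le (mem_matchingIds.1 hx).1
      (mem_matchingIds.1 hx).2, mul_add, htwo]
  simp [card_matchingIds]

/-- The index of the matching edge at a vertex outside the clique. -/
def edgeIndex (h x : ℕ) : Option ℕ := if h ≤ x then some ((x - h) / 2) else none

lemma mem_cliqueMatchingIds_congr (hI : ∀ i, edgeIndex h x = some i → (i ∈ I ↔ i ∈ I')) :
    x ∈ cliqueMatchingIds h I ↔ x ∈ cliqueMatchingIds h I' := by
  rw [mem_cliqueMatchingIds, mem_cliqueMatchingIds]
  exact or_congr_right (and_congr_right fun hx => hI _ (if_pos hx))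

/-- The index of the matching edge whose presence decides the answer to a query. A pair `x, y` with
`x` and `y` on different matching edges is never adjacent, so that `x` alone determines it. -/
def touchedIndex (h : ℕ) : Query → Option ℕ
  | .randVert => none
  | .randEdge => none
  | .randNbr x => edgeIndex h x
  | .degree x => edgeIndex h x
  | .pair x _ => edgeIndex h x
  | .fullNbrHood x => edgeIndex h x

lemma nbrIds_cliqueMatchingInput_congr (hI : ∀ i, edgeIndex h x = some i → (i ∈ I ↔ i ∈ I')) :
    (cliqueMatchingInput hh I).nbrIds x = (cliqueMatchingInput hh I').nbrIds x := by
  refine (inducedFrom_cliqueMatchingInput hh I).nbrIds_congr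
    (inducedFrom_cliqueMatchingInput hh I') fun y hy => ?_
  rw [idFinset_cliqueMatchingInput, idFinset_cliqueMatchingInput]
  rcases hy with rfl | hy
  · exact mem_cliqueMatchingIds_congr hI
  · rw [mem_cliqueMatchingIds_iff_of_adj hy, mem_cliqueMatchingIds_iff_of_adj hy]
    exact mem_cliqueMatchingIds_congr hI

lemma answer_pair_cliqueMatchingInput_congr (y : ℕ)
    (hI : ∀ i, edgeIndex h x = some i → (i ∈ I ↔ i ∈ I')) :
    (cliqueMatchingInput hh I).answer (.pair x y) =
      (cliqueMatchingInput hh I').answer (.pair x y) := by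
  refine ((inducedFrom_cliqueMatchingInput hh I).answer_pair x y).trans
    (Eq.trans ?_ ((inducedFrom_cliqueMatchingInput hh I').answer_pair x y).symm)
  congr 2
  rw [idFinset_cliqueMatchingInput, idFinset_cliqueMatchingInput, eq_iff_iff]
  by_cases hxy : (cliqueMatching h).Adj x y
  · rw [mem_cliqueMatchingIds_iff_of_adj hxy, mem_cliqueMatchingIds_iff_of_adj hxy,
      mem_cliqueMatchingIds_congr hI]
  · simp [hxy]

lemma answer_cliqueMatchingInput_congr {q : Query} (hv : q ≠ .randVert) (he : q ≠ .randEdge)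
    (hq : ∀ i, touchedIndex h q = some i → (i ∈ I ↔ i ∈ I')) :
    (cliqueMatchingInput hh I).answer q = (cliqueMatchingInput hh I').answer q := by
  cases q with
  | randVert => exact absurd rfl hv
  | randEdge => exact absurd rfl he
  | randNbr x => exact InputGraph.answer_randNbr_congr (nbrIds_cliqueMatchingInput_congr hh hq)
  | degree x => exact InputGraph.answer_degree_congr (nbrIds_cliqueMatchingInput_congr hh hq)
  | fullNbrHood x =>
    exact InputGraph.answer_fullNbrHood_congr (nbrIds_cliqueMatchingInput_congr hh hq)
  | pair x y => exact answer_pair_cliqueMatchingInput_congr hh y hq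

end CliqueMatching

/-! ### The lazy oracle -/

/-- What an algorithm knows about the set of indices of the matching edges of the input: the indices
known to belong to it and the indices known not to belong to it. -/
structure Knowledge where
  present : Finset ℕ
  absent : Finset ℕ

namespace Knowledge

variable {M L i : ℕ} {c : Knowledge} {I : Finset ℕ}

/-- The knowledge `c` together with the presence of `i`. -/
def insertPresent (c : Knowledge) (i : ℕ) : Knowledge := ⟨insert i c.present, c.absent⟩

/-- The knowledge `c` together with the absence of `i`. -/
def insertAbsent (c : Knowledge) (i : ℕ) : Knowledge := ⟨c.present, insert i c.absent⟩

/-- The indices below `M` about which nothing is known. -/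
def unknown (M : ℕ) (c : Knowledge) : Finset ℕ := Finset.range M \ (c.present ∪ c.absent)

/-- The knowledge is about indices below `M` and not contradictory. -/
structure Valid (M : ℕ) (c : Knowledge) : Prop where
  present_subset : c.present ⊆ Finset.range M
  absent_subset : c.absent ⊆ Finset.range M
  disjoint : Disjoint c.present c.absent

/-- The sets of `L` indices below `M` that agree with the given knowledge. -/
def indexSets (M L : ℕ) (c : Knowledge) : Finset (Finset ℕ) :=
  (Finset.powersetCard L (Finset.range M)).filter fun I => c.present ⊆ I ∧ Disjoint I c.absent

lemma mem_unknown : i ∈ c.unknown M ↔ i ∈ Finset.range M ∧ i ∉ c.present ∧ i ∉ c.absent := by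
  simp only [unknown, Finset.mem_sdiff, Finset.mem_union, not_or]

lemma mem_indexSets : I ∈ c.indexSets M L ↔
    (I ⊆ Finset.range M ∧ I.card = L) ∧ c.present ⊆ I ∧ Disjoint I c.absent := by
  rw [indexSets, Finset.mem_filter, Finset.mem_powersetCard]

lemma sdiff_subset_unknown (hI : I ∈ c.indexSets M L) : I \ c.present ⊆ c.unknown M := by
  intro i hi
  obtain ⟨⟨hrange, -⟩, -, habsent⟩ := mem_indexSets.1 hI
  rw [Finset.mem_sdiff] at hi
  exact mem_unknown.2 ⟨hrange hi.1, hi.2, Finset.disjoint_left.1 habsent hi.1⟩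

lemma disjoint_present_of_subset_unknown (hI : I ⊆ c.unknown M) : Disjoint I c.present :=
  Finset.disjoint_left.2 fun _ hi => (mem_unknown.1 (hI hi)).2.1

lemma card_insertPresent (hi : i ∈ c.unknown M) :
    (c.insertPresent i).present.card = c.present.card + 1 :=
  Finset.card_insert_of_notMem (mem_unknown.1 hi).2.1

lemma card_insertAbsent (hi : i ∈ c.unknown M) :
    (c.insertAbsent i).absent.card = c.absent.card + 1 :=
  Finset.card_insert_of_notMem (mem_unknown.1 hi).2.2

namespace Valid

variable (hc : c.Valid M)
include hc

lemma card_unknown : (c.unknown M).card = M - (c.present.card + c.absent.card) := by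
  rw [unknown, Finset.card_sdiff_of_subset
    (Finset.union_subset hc.present_subset hc.absent_subset), Finset.card_range,
    Finset.card_union_of_disjoint hc.disjoint]

lemma insertPresent (hi : i ∈ c.unknown M) : (c.insertPresent i).Valid M where
  present_subset := Finset.insert_subset (mem_unknown.1 hi).1 hc.present_subset
  absent_subset := hc.absent_subset
  disjoint := Finset.disjoint_insert_left.2 ⟨(mem_unknown.1 hi).2.2, hc.disjoint⟩

lemma insertAbsent (hi : i ∈ c.unknown M) : (c.insertAbsent i).Valid M where
  present_subset := hc.present_subset
  absent_subset := Finset.insert_subset (mem_unknown.1 hi).1 hc.absent_subset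
  disjoint := Finset.disjoint_insert_right.2 ⟨(mem_unknown.1 hi).2.1, hc.disjoint⟩

lemma union_present_mem_indexSets (hI : I ⊆ c.unknown M) :
    I ∪ c.present ∈ c.indexSets M (I.card + c.present.card) :=
  mem_indexSets.2 ⟨⟨Finset.union_subset (hI.trans Finset.sdiff_subset) hc.present_subset,
    Finset.card_union_of_disjoint (disjoint_present_of_subset_unknown hI)⟩,
    Finset.subset_union_right, Finset.disjoint_union_left.2
      ⟨Finset.disjoint_left.2 fun _ hi => (mem_unknown.1 (hI hi)).2.2, hc.disjoint⟩⟩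

lemma card_indexSets (hL : c.present.card ≤ L) : (c.indexSets M L).card =
    (M - (c.present.card + c.absent.card)).choose (L - c.present.card) := by
  rw [← hc.card_unknown, ← Finset.card_powersetCard]
  refine Finset.card_bij' (fun I _ => I \ c.present) (fun I _ => I ∪ c.present)
    (fun I hI => Finset.mem_powersetCard.2 ⟨sdiff_subset_unknown hI, ?_⟩) (fun I hI => ?_)
    (fun I hI => Finset.sdiff_union_of_subset (mem_indexSets.1 hI).2.1) (fun I hI =>
    Finset.union_sdiff_cancel_right
      (disjoint_present_of_subset_unknown (Finset.mem_powersetCard.1 hI).1))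
  · obtain ⟨⟨-, hcard⟩, hpresent, -⟩ := mem_indexSets.1 hI
    rw [Finset.card_sdiff_of_subset hpresent, hcard]
  · obtain ⟨hunknown, hcard⟩ := Finset.mem_powersetCard.1 hI
    have hmem := hc.union_present_mem_indexSets hunknown
    rwa [hcard, Nat.sub_add_cancel hL] at hmem

lemma card_indexSets_insertPresent (hL : c.present.card < L) (hi : i ∈ c.unknown M) :
    (c.unknown M).card * ((c.insertPresent i).indexSets M L).card =
      (L - c.present.card) * (c.indexSets M L).card := by
  have hpos : 0 < M - (c.present.card + c.absent.card) :=
    hc.card_unknown ▸ Finset.card_pos.2 ⟨i, hi⟩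
  have hcard := card_insertPresent hi
  rw [(hc.insertPresent hi).card_indexSets (by omega), hc.card_indexSets hL.le, hc.card_unknown,
    hcard, Knowledge.insertPresent]
  obtain ⟨N, hN⟩ := Nat.exists_eq_add_of_lt hpos
  obtain ⟨l, hl⟩ := Nat.exists_eq_add_of_lt (Nat.sub_pos_of_lt hL)
  rw [hN, hl, show M - (c.present.card + 1 + c.absent.card) = N by omega,
    show L - (c.present.card + 1) = l by omega, zero_add, zero_add, Nat.add_one_mul_choose_eq,
    mul_comm]

lemma card_indexSets_insertAbsent (hL : c.present.card ≤ L) (hi : i ∈ c.unknown M) :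
    (c.unknown M).card * ((c.insertAbsent i).indexSets M L).card =
      ((c.unknown M).card - (L - c.present.card)) * (c.indexSets M L).card := by
  have hpos : 0 < M - (c.present.card + c.absent.card) :=
    hc.card_unknown ▸ Finset.card_pos.2 ⟨i, hi⟩
  have hcard := card_insertAbsent hi
  rw [(hc.insertAbsent hi).card_indexSets hL, hc.card_indexSets hL, hc.card_unknown, hcard,
    Knowledge.insertAbsent]
  obtain ⟨N, hN⟩ := Nat.exists_eq_add_of_lt hpos
  rw [hN, show M - (c.present.card + (c.absent.card + 1)) = N by omega, zero_add, mul_comm,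
    Nat.choose_mul_succ_eq, mul_comm]

end Valid

end Knowledge

/-- The number of indices about which something is known. -/
def Knowledge.size (c : Knowledge) : ℕ := c.present.card + c.absent.card

/-- `c.Step M c'`: one query can turn the knowledge `c` into `c'`. -/
inductive Knowledge.Step (M : ℕ) (c : Knowledge) : Knowledge → Prop
  | refl : Step M c c
  | present {i : ℕ} (hi : i ∈ c.unknown M) : Step M c (c.insertPresent i)
  | absent {i : ℕ} (hi : i ∈ c.unknown M) : Step M c (c.insertAbsent i)

namespace Knowledge.Step

variable {M : ℕ} {c c' : Knowledge} (hstep : c.Step M c')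
include hstep

lemma valid (hc : c.Valid M) : c'.Valid M := by
  cases hstep with
  | refl => exact hc
  | present hi => exact hc.insertPresent hi
  | absent hi => exact hc.insertAbsent hi

lemma size_le : c'.size ≤ c.size + 1 := by
  cases hstep with
  | refl => exact Nat.le_succ _
  | present hi =>
    rw [size, card_insertPresent hi]
    exact (Nat.add_right_comm _ _ _).le
  | absent hi =>
    rw [size, card_insertAbsent hi]
    exact le_rfl

lemma indexSets_subset (L : ℕ) : c'.indexSets M L ⊆ c.indexSets M L := by
  cases hstep with
  | refl => exact subset_rfl
  | present hi =>
    exact Finset.monotone_filter_right _ fun I _ hI => ⟨(Finset.insert_subset_iff.1 hI.1).2, hI.2⟩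
  | absent hi =>
    exact Finset.monotone_filter_right _ fun I _ hI =>
      ⟨hI.1, (Finset.disjoint_insert_right.1 hI.2).2⟩

end Knowledge.Step

section LazyOracle

/-- The edges of the clique. -/
def cliqueEdges (h : ℕ) : Finset (Sym2 ℕ) := (Finset.range h).offDiag.image Sym2.mk.uncurry

lemma card_cliqueEdges (h : ℕ) : (cliqueEdges h).card = h.choose 2 := by
  rw [cliqueEdges, Sym2.card_image_offDiag, Finset.card_range]

variable {h : ℕ}

lemma cliqueEdges_nonempty (hh : 2 ≤ h) : (cliqueEdges h).Nonempty := by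
  rw [← Finset.card_pos, card_cliqueEdges]
  exact Nat.choose_pos hh

lemma cliqueEdges_subset (hh : 2 ≤ h) (I : Finset ℕ) :
    cliqueEdges h ⊆ (cliqueMatchingInput hh I).idEdgeFinset := by
  intro e he
  obtain ⟨⟨x, y⟩, hxy, rfl⟩ := Finset.mem_image.1 he
  rw [Finset.mem_offDiag, Finset.mem_range, Finset.mem_range] at hxy
  have hmem {z : ℕ} (hz : z < h) : z ∈ (cliqueMatchingInput hh I).idFinset := by
    rw [idFinset_cliqueMatchingInput]
    exact mem_cliqueMatchingIds.2 (Or.inl hz)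
  exact (inducedFrom_cliqueMatchingInput hh I).mk_mem_idEdgeFinset (hmem hxy.1) (hmem hxy.2.1)
    ((cliqueMatching_adj_of_lt hxy.1).2 ⟨hxy.2.2.symm, hxy.2.1⟩)

open Classical in
/-- Answers that do not depend on the set of matching edges: random vertices are ends of matching
edges with an unknown index, random edges are clique edges, and matching edges that are not known
to be present are taken to be absent. The junk value in the first case is never used, since few
queries leave some index unknown. -/
def lazyAnswer (hh : 2 ≤ h) (M : ℕ) (c : Knowledge) : (q : Query) → PMF q.Response
  | .randVert =>
      if hN : (matchingIds h (c.unknown M)).Nonempty then PMF.uniformOfFinset _ hN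
      else PMF.pure (0 : ℕ)
  | .randEdge => PMF.uniformOfFinset _ (cliqueEdges_nonempty hh)
  | q => (cliqueMatchingInput hh c.present).answer q

/-- The knowledge after the index `i` of a matching edge was touched by a query that is answered
as if all unknown matching edges were absent. -/
def Knowledge.afterMiss (M : ℕ) (c : Knowledge) : Option ℕ → Knowledge
  | none => c
  | some i => if i ∈ c.unknown M then c.insertAbsent i else c

/-- The knowledge after the answer of `lazyAnswer` to a query. -/
def Knowledge.learn (h M : ℕ) (c : Knowledge) : (q : Query) → q.Response → Knowledge
  | .randVert, x => c.insertPresent (((show ℕ from x) - h) / 2)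
  | q, _ => c.afterMiss M (touchedIndex h q)

/-- Run `A` with at most `k` further queries and the answers of `lazyAnswer`. -/
def lazyRun (hh : 2 ≤ h) (M : ℕ) (A : QueryAlgorithm) : ℕ → A.State → Knowledge → PMF (Option ℝ)
  | 0, s, _ =>
      match A.next s with
      | .inr x => PMF.pure (some x)
      | .inl _ => PMF.pure none
  | k + 1, s, c =>
      match A.next s with
      | .inr x => PMF.pure (some x)
      | .inl ⟨q, f⟩ => (lazyAnswer hh M c q).bind fun r => (f r).bind fun s' =>
          lazyRun hh M A k s' (c.learn h M q r)

/-- With at most `K` queries, the answers of `lazyAnswer` are those of an input with a clique on `h`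
vertices and a random set of `L` of the `M` possible matching edges, except with probability at most
`1 - ρ` for each query. -/
structure LazyBound (h M L K : ℕ) (ρ : ℝ≥0∞) : Prop where
  le_one : ρ ≤ 1
  K_le : K ≤ L
  K_lt : K < M
  vertex : ρ * ((h + 2 * L : ℕ) : ℝ≥0∞) ≤ ((2 * (L - K) : ℕ) : ℝ≥0∞)
  edge : ρ * ((h.choose 2 + L : ℕ) : ℝ≥0∞) ≤ (h.choose 2 : ℕ)
  absent : ∀ N : ℕ, M ≤ N + K → ρ * (N : ℝ≥0∞) ≤ ((N - L : ℕ) : ℝ≥0∞)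

lemma mul_natCast_inv_le {a b : ℝ≥0∞} {m n : ℕ} (hm : m ≠ 0) (hn : n ≠ 0) (h : a * n ≤ b * m) :
    a * (m : ℝ≥0∞)⁻¹ ≤ b * (n : ℝ≥0∞)⁻¹ := by
  rw [← div_eq_mul_inv, ← div_eq_mul_inv,
    ENNReal.div_le_iff (Nat.cast_ne_zero.2 hm) (ENNReal.natCast_ne_top m), ENNReal.mul_comm_div,
    ← mul_div_assoc]
  exact (ENNReal.le_div_iff_mul_le (Or.inl (Nat.cast_ne_zero.2 hn))
    (Or.inl (ENNReal.natCast_ne_top n))).2 h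

variable {M L K : ℕ} {ρ : ℝ≥0∞} {c : Knowledge}

/-- Moving from the knowledge `c` to `c'` by the answer `r` costs at most a factor `ρ`: the
probability of `r` under `lazyAnswer` is compared with a common lower bound `w` for its probability
on all the inputs that agree with `c'`. -/
structure Simulates (hh : 2 ≤ h) (M L : ℕ) (ρ : ℝ≥0∞) (c : Knowledge) (q : Query) (r : q.Response)
    (c' : Knowledge) : Prop where
  step : c.Step M c'
  weight : ∃ w : ℝ≥0∞,
    ρ * (c.indexSets M L).card * lazyAnswer hh M c q r ≤ (c'.indexSets M L).card * w ∧
    ∀ I ∈ c'.indexSets M L, w ≤ (cliqueMatchingInput hh I).answer q r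

lemma Knowledge.Valid.unknown_nonempty (hc : c.Valid M) (hM : c.size < M) :
    (c.unknown M).Nonempty := by
  rw [← Finset.card_pos, hc.card_unknown]
  exact Nat.sub_pos_of_lt hM

lemma matchingIds_nonempty {I : Finset ℕ} (hI : I.Nonempty) : (matchingIds h I).Nonempty := by
  rw [← Finset.card_pos, card_matchingIds]
  exact Nat.mul_pos two_pos hI.card_pos

lemma lazyAnswer_randVert (hh : 2 ≤ h) (hU : (c.unknown M).Nonempty) :
    lazyAnswer hh M c .randVert = PMF.uniformOfFinset _ (matchingIds_nonempty (h := h) hU) :=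
  dif_pos (matchingIds_nonempty hU)

lemma Knowledge.Valid.mul_card_indexSets_le_insertPresent (hc : c.Valid M)
    (hρ : LazyBound h M L K ρ) (hK : c.size < K) {i : ℕ} (hi : i ∈ c.unknown M) :
    ρ * (c.indexSets M L).card * ((h + 2 * L : ℕ) : ℝ≥0∞) ≤
      ((c.insertPresent i).indexSets M L).card * ((2 * (c.unknown M).card : ℕ) : ℝ≥0∞) := by
  have hpresent : c.present.card ≤ c.size := Nat.le_add_right _ _
  have hKL := hρ.K_le
  calc _ = ρ * ((h + 2 * L : ℕ) : ℝ≥0∞) * (c.indexSets M L).card := mul_right_comm _ _ _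
    _ ≤ ((2 * (L - K) : ℕ) : ℝ≥0∞) * (c.indexSets M L).card := by gcongr; exact hρ.vertex
    _ ≤ ((2 * (L - c.present.card) : ℕ) : ℝ≥0∞) * (c.indexSets M L).card := by gcongr; omega
    _ = _ := by
      rw [← Nat.cast_mul, ← Nat.cast_mul, mul_assoc,
        ← hc.card_indexSets_insertPresent (by omega) hi, mul_comm (c.unknown M).card,
        mul_left_comm]

lemma Knowledge.Valid.mul_card_indexSets_le_insertAbsent (hc : c.Valid M)
    (hρ : LazyBound h M L K ρ) (hK : c.size < K) {i : ℕ} (hi : i ∈ c.unknown M) :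
    ρ * (c.indexSets M L).card ≤ ((c.insertAbsent i).indexSets M L).card := by
  have hpresent : c.present.card ≤ c.size := Nat.le_add_right _ _
  have hKL := hρ.K_le
  set U := (c.unknown M).card with hU
  have hMU : M ≤ U + K := by rw [hU, hc.card_unknown]; simp only [size] at hK; omega
  have hU0 : (U : ℝ≥0∞) ≠ 0 := Nat.cast_ne_zero.2 (Finset.card_pos.2 ⟨i, hi⟩).ne'
  refine (ENNReal.mul_le_mul_iff_right hU0 (ENNReal.natCast_ne_top _)).1 ?_
  calc _ = ρ * (U : ℝ≥0∞) * (c.indexSets M L).card := by ring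
    _ ≤ ((U - L : ℕ) : ℝ≥0∞) * (c.indexSets M L).card := by gcongr; exact hρ.absent U hMU
    _ ≤ ((U - (L - c.present.card) : ℕ) : ℝ≥0∞) * (c.indexSets M L).card := by gcongr; omega
    _ = _ := by
      rw [← Nat.cast_mul, ← hc.card_indexSets_insertAbsent (by omega) hi, Nat.cast_mul]

lemma simulates_randVert (hh : 2 ≤ h) (hρ : LazyBound h M L K ρ) (hc : c.Valid M)
    (hK : c.size < K) {x : ℕ} (hx : x ∈ (lazyAnswer hh M c .randVert).support) :
    Simulates hh M L ρ c .randVert x (c.learn h M .randVert x) := by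
  have hU : (c.unknown M).Nonempty := hc.unknown_nonempty (hK.trans hρ.K_lt)
  have hlazy := lazyAnswer_randVert hh hU
  have hx' : x ∈ matchingIds h (c.unknown M) :=
    (PMF.mem_support_uniformOfFinset_iff _ _).1 (hlazy ▸ hx)
  obtain ⟨hhx, hi⟩ := mem_matchingIds.1 hx'
  have hval : lazyAnswer hh M c .randVert x = ((2 * (c.unknown M).card : ℕ) : ℝ≥0∞)⁻¹ := by
    rw [← card_matchingIds h, hlazy]
    exact PMF.uniformOfFinset_apply_of_mem _ hx'
  refine ⟨.present hi, ((h + 2 * L : ℕ) : ℝ≥0∞)⁻¹, ?_, fun I hI => le_of_eq ?_⟩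
  · rw [hval]
    exact mul_natCast_inv_le (Nat.mul_pos two_pos hU.card_pos).ne' (by omega)
      (hc.mul_card_indexSets_le_insertPresent hρ hK hi)
  · obtain ⟨⟨-, hcard⟩, hpresent, -⟩ := Knowledge.mem_indexSets.1 hI
    have hxI : x ∈ (cliqueMatchingInput hh I).idFinset := by
      rw [idFinset_cliqueMatchingInput]
      exact mem_cliqueMatchingIds.2 (Or.inr ⟨hhx, hpresent (Finset.mem_insert_self _ _)⟩)
    rw [InputGraph.answer_randVert_apply hxI, n_cliqueMatchingInput, hcard]

lemma simulates_randEdge (hh : 2 ≤ h) (hρ : LazyBound h M L K ρ) {e : Sym2 ℕ}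
    (he : e ∈ (lazyAnswer hh M c .randEdge).support) :
    Simulates hh M L ρ c .randEdge e (c.learn h M .randEdge e) := by
  have he' : e ∈ cliqueEdges h :=
    (PMF.mem_support_uniformOfFinset_iff (cliqueEdges_nonempty hh) e).1 he
  have hval : lazyAnswer hh M c .randEdge e = (h.choose 2 : ℝ≥0∞)⁻¹ := by
    rw [← card_cliqueEdges]
    exact PMF.uniformOfFinset_apply_of_mem (cliqueEdges_nonempty hh) he'
  have hpos := Nat.choose_pos hh
  refine ⟨.refl, ((h.choose 2 + L : ℕ) : ℝ≥0∞)⁻¹, ?_, fun I hI => le_of_eq ?_⟩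
  · rw [hval]
    refine mul_natCast_inv_le hpos.ne' (by omega) ?_
    rw [mul_right_comm, mul_comm]
    exact mul_le_mul_right hρ.edge _
  · rw [InputGraph.answer_randEdge_apply (cliqueEdges_subset hh I he'),
      card_edgeFinset_cliqueMatchingInput, (Knowledge.mem_indexSets.1 hI).1.2]

lemma Knowledge.step_afterMiss (c : Knowledge) (j : Option ℕ) : c.Step M (c.afterMiss M j) := by
  cases j with
  | none => exact .refl
  | some i =>
    rw [afterMiss]
    split_ifs with hi
    · exact .absent hi
    · exact .refl

lemma Knowledge.Valid.mul_card_indexSets_le_afterMiss (hc : c.Valid M)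
    (hρ : LazyBound h M L K ρ) (hK : c.size < K) (j : Option ℕ) :
    ρ * (c.indexSets M L).card ≤ ((c.afterMiss M j).indexSets M L).card := by
  have hself : ρ * (c.indexSets M L).card ≤ (c.indexSets M L).card :=
    mul_le_of_le_one_left zero_le hρ.le_one
  cases j with
  | none => exact hself
  | some i =>
    rw [afterMiss]
    split_ifs with hi
    · exact hc.mul_card_indexSets_le_insertAbsent hρ hK hi
    · exact hself

lemma Knowledge.mem_iff_mem_present_of_afterMiss {i : ℕ} {I : Finset ℕ}
    (hI : I ∈ (c.afterMiss M (some i)).indexSets M L) : i ∈ I ↔ i ∈ c.present := by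
  obtain ⟨⟨hrange, -⟩, hpresent, habsent⟩ :=
    mem_indexSets.1 ((c.step_afterMiss _).indexSets_subset L hI)
  refine ⟨fun hi => ?_, fun hi => hpresent hi⟩
  by_contra hnot
  have hunknown : i ∈ c.unknown M :=
    mem_unknown.2 ⟨hrange hi, hnot, Finset.disjoint_left.1 habsent hi⟩
  rw [afterMiss, if_pos hunknown] at hI
  exact Finset.disjoint_left.1 (mem_indexSets.1 hI).2.2 hi (Finset.mem_insert_self _ _)

lemma simulates_of_ne (hh : 2 ≤ h) (hρ : LazyBound h M L K ρ) (hc : c.Valid M) (hK : c.size < K)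
    {q : Query} (hv : q ≠ .randVert) (he : q ≠ .randEdge) (r : q.Response) :
    Simulates hh M L ρ c q r (c.learn h M q r) := by
  have hlearn : c.learn h M q r = c.afterMiss M (touchedIndex h q) := by
    cases q <;> first | rfl | exact absurd rfl hv
  have hlazy : lazyAnswer hh M c q = (cliqueMatchingInput hh c.present).answer q := by
    cases q <;> first | rfl | exact absurd rfl hv | exact absurd rfl he
  rw [hlearn]
  refine ⟨c.step_afterMiss _, lazyAnswer hh M c q r, ?_, fun I hI => le_of_eq ?_⟩
  · gcongr
    exact hc.mul_card_indexSets_le_afterMiss hρ hK _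
  · rw [hlazy, answer_cliqueMatchingInput_congr hh hv he fun i hi => ?_]
    rw [hi] at hI
    exact (Knowledge.mem_iff_mem_present_of_afterMiss hI).symm

lemma simulates_learn (hh : 2 ≤ h) (hρ : LazyBound h M L K ρ) (hc : c.Valid M) (hK : c.size < K)
    {q : Query} {r : q.Response} (hr : r ∈ (lazyAnswer hh M c q).support) :
    Simulates hh M L ρ c q r (c.learn h M q r) := by
  by_cases hv : q = .randVert
  · subst hv
    exact simulates_randVert hh hρ hc hK hr
  by_cases he : q = .randEdge
  · subst he
    exact simulates_randEdge hh hρ hr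
  exact simulates_of_ne hh hρ hc hK hv he r

lemma lazyRun_step_le (hh : 2 ≤ h) (hρ : LazyBound h M L K ρ) (hc : c.Valid M) (hK : c.size < K)
    {q : Query} {β : Type*} {X : Set β} {t : ℝ≥0∞} {Ψ : Knowledge → q.Response → PMF β}
    {F : Finset ℕ → q.Response → PMF β}
    (H : ∀ (r : q.Response) (c' : Knowledge), c'.Valid M → c'.size ≤ c.size + 1 →
      t * (c'.indexSets M L).card * (Ψ c' r).toOuterMeasure X ≤
        ∑ I ∈ c'.indexSets M L, (F I r).toOuterMeasure X) :
    ρ * t * (c.indexSets M L).card *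
        ((lazyAnswer hh M c q).bind fun r => Ψ (c.learn h M q r) r).toOuterMeasure X ≤
      ∑ I ∈ c.indexSets M L,
        (((cliqueMatchingInput hh I).answer q).bind (F I)).toOuterMeasure X := by
  refine mul_toOuterMeasure_bind_le_sum fun r hr => ?_
  obtain ⟨hstep, w, hw, hwI⟩ := simulates_learn hh hρ hc hK hr
  set c' := c.learn h M q r
  calc _ = t * (ρ * (c.indexSets M L).card * lazyAnswer hh M c q r) *
        (Ψ c' r).toOuterMeasure X := by ring
    _ ≤ t * ((c'.indexSets M L).card * w) * (Ψ c' r).toOuterMeasure X := by gcongr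
    _ = w * (t * (c'.indexSets M L).card * (Ψ c' r).toOuterMeasure X) := by ring
    _ ≤ w * ∑ I ∈ c'.indexSets M L, (F I r).toOuterMeasure X := by
      gcongr
      exact H r c' (hstep.valid hc) hstep.size_le
    _ = ∑ I ∈ c'.indexSets M L, w * (F I r).toOuterMeasure X := Finset.mul_sum _ _ _
    _ ≤ ∑ I ∈ c'.indexSets M L,
        (cliqueMatchingInput hh I).answer q r * (F I r).toOuterMeasure X :=
      Finset.sum_le_sum fun I hI => mul_le_mul_left (hwI I hI) _
    _ ≤ _ := Finset.sum_le_sum_of_subset (hstep.indexSets_subset L)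

lemma pow_mul_card_mul_le_sum_const (hρ : ρ ≤ 1) (k : ℕ) {ι : Type*} (s : Finset ι) (x : ℝ≥0∞) :
    ρ ^ k * s.card * x ≤ ∑ _i ∈ s, x := by
  rw [Finset.sum_const, nsmul_eq_mul, mul_assoc]
  exact mul_le_of_le_one_left zero_le (pow_le_one₀ zero_le hρ)

lemma lazyRun_le (hh : 2 ≤ h) (hρ : LazyBound h M L K ρ) (A : QueryAlgorithm) (k : ℕ)
    (s : A.State) (hc : c.Valid M) (hK : c.size + k ≤ K) (X : Set (Option ℝ)) :
    ρ ^ k * (c.indexSets M L).card * (lazyRun hh M A k s c).toOuterMeasure X ≤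
      ∑ I ∈ c.indexSets M L, (A.runFrom (cliqueMatchingInput hh I) k s).toOuterMeasure X := by
  induction k generalizing s c with
  | zero =>
    cases hn : A.next s <;> simp only [lazyRun, QueryAlgorithm.runFrom, hn] <;>
      exact pow_mul_card_mul_le_sum_const hρ.le_one 0 _ _
  | succ k ih =>
    cases hn : A.next s with
    | inr x =>
      simp only [lazyRun, QueryAlgorithm.runFrom, hn]
      exact pow_mul_card_mul_le_sum_const hρ.le_one _ _ _
    | inl qf =>
      simp only [lazyRun, QueryAlgorithm.runFrom, hn, pow_succ']
      refine lazyRun_step_le hh hρ hc (by omega)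
        (Ψ := fun c' r => (qf.2 r).bind fun s' => lazyRun hh M A k s' c') fun r c' hc' hsize => ?_
      refine mul_toOuterMeasure_bind_le_sum fun s' _ => ?_
      calc _ = qf.2 r s' * (ρ ^ k * (c'.indexSets M L).card *
            (lazyRun hh M A k s' c').toOuterMeasure X) := by ring
        _ ≤ _ := mul_le_mul_right (ih s' hc' (by omega)) _
        _ = _ := Finset.mul_sum _ _ _

end LazyOracle

/-- The knowledge before the first query. -/
def Knowledge.empty : Knowledge := ⟨∅, ∅⟩

section Indistinguishable

variable {h M L L' K : ℕ} {ρ : ℝ≥0∞} {A : QueryAlgorithm}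

lemma Knowledge.valid_empty (M : ℕ) : Knowledge.empty.Valid M :=
  ⟨Finset.empty_subset _, Finset.empty_subset _, Finset.disjoint_empty_left _⟩

lemma Knowledge.card_of_mem_indexSets {c : Knowledge} {I : Finset ℕ} (hI : I ∈ c.indexSets M L) :
    I.card = L :=
  (mem_indexSets.1 hI).1.2

lemma Knowledge.card_indexSets_empty_pos (hL : L ≤ M) :
    0 < (Knowledge.empty.indexSets M L).card := by
  rw [(valid_empty M).card_indexSets (Nat.zero_le _)]
  exact Nat.choose_pos hL

lemma pow_mul_lazyRun_le (hh : 2 ≤ h) (hρ : LazyBound h M L K ρ) (hL : L ≤ M) {X : Set (Option ℝ)}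
    {y : ℝ≥0∞} (hX : ∀ I : Finset ℕ, I.card = L →
      (A.init.bind (A.runFrom (cliqueMatchingInput hh I) K)).toOuterMeasure X ≤ y) :
    ρ ^ K * (A.init.bind fun s => lazyRun hh M A K s .empty).toOuterMeasure X ≤ y := by
  set N := (Knowledge.empty.indexSets M L).card
  have hN0 : (N : ℝ≥0∞) ≠ 0 := Nat.cast_ne_zero.2 (Knowledge.card_indexSets_empty_pos hL).ne'
  have hrun : ρ ^ K * N * (A.init.bind fun s => lazyRun hh M A K s .empty).toOuterMeasure X ≤
      ∑ I ∈ Knowledge.empty.indexSets M L,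
        (A.init.bind (A.runFrom (cliqueMatchingInput hh I) K)).toOuterMeasure X := by
    refine mul_toOuterMeasure_bind_le_sum fun s _ => ?_
    calc _ = A.init s * (ρ ^ K * N * (lazyRun hh M A K s .empty).toOuterMeasure X) := by ring
      _ ≤ _ := mul_le_mul_right
        (lazyRun_le hh hρ A K s (Knowledge.valid_empty M) (Nat.zero_add K).le X) _
      _ = _ := Finset.mul_sum _ _ _
  refine (ENNReal.mul_le_mul_iff_right hN0 (ENNReal.natCast_ne_top _)).1 ?_
  calc _ = ρ ^ K * N * (A.init.bind fun s => lazyRun hh M A K s .empty).toOuterMeasure X := by ring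
    _ ≤ ∑ _I ∈ Knowledge.empty.indexSets M L, y :=
      hrun.trans (Finset.sum_le_sum fun I hI => hX I (Knowledge.card_of_mem_indexSets hI))
    _ = N * y := by rw [Finset.sum_const, nsmul_eq_mul]

lemma pow_le_of_distinguishes (hh : 2 ≤ h) (hρ : LazyBound h M L K ρ) (hρ' : LazyBound h M L' K ρ)
    (hL : L ≤ M) (hL' : L' ≤ M) {S : Set ℝ} {x y : ℝ≥0∞}
    (hx : ∀ I : Finset ℕ, I.card = L → x ≤ A.probWithin (cliqueMatchingInput hh I) K S)
    (hy : ∀ I : Finset ℕ, I.card = L' → A.probWithin (cliqueMatchingInput hh I) K S ≤ y) :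
    ρ ^ K ≤ y + (1 - x) := by
  set p := A.init.bind fun s => lazyRun hh M A K s .empty
  have hcompl : ρ ^ K * p.toOuterMeasure (some '' S)ᶜ ≤ 1 - x := by
    refine pow_mul_lazyRun_le hh hρ hL fun I hI => ?_
    have hadd := toOuterMeasure_add_compl (A.init.bind (A.runFrom (cliqueMatchingInput hh I) K))
      (some '' S)
    have hxI : x ≤ 1 := (hx I hI).trans (le_self_add.trans_eq hadd)
    exact ENNReal.le_sub_of_add_le_left (hxI.trans_lt ENNReal.one_lt_top).ne
      ((add_le_add_left (hx I hI) _).trans_eq hadd)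
  calc ρ ^ K = ρ ^ K * p.toOuterMeasure (some '' S) + ρ ^ K * p.toOuterMeasure (some '' S)ᶜ := by
        rw [← mul_add, toOuterMeasure_add_compl, mul_one]
    _ ≤ y + (1 - x) := add_le_add (pow_mul_lazyRun_le hh hρ' hL' hy) hcompl

end Indistinguishable

/-- The average degree of a clique on `h` vertices together with `L` matching edges. -/
def cliqueMatchingDeg (h L : ℕ) : ℝ := ((h : ℝ) * (h - 1) + 2 * L) / (h + 2 * L)

lemma avgDeg_cliqueMatchingInput {h : ℕ} (hh : 2 ≤ h) (I : Finset ℕ) :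
    (cliqueMatchingInput hh I).avgDeg = cliqueMatchingDeg h I.card := by
  rw [InputGraph.avgDeg_eq, card_edgeFinset_cliqueMatchingInput, n_cliqueMatchingInput,
    cliqueMatchingDeg]
  push_cast
  rw [Nat.cast_choose_two]
  ring

/-- The approximations of `d` within a factor `c`. -/
def approxSet (c d : ℝ) : Set ℝ := {x | d / c ≤ x ∧ x ≤ c * d}

lemma disjoint_approxSet {c d d' : ℝ} (hc : 0 < c) (h : c ^ 2 * d' < d) :
    Disjoint (approxSet c d) (approxSet c d') := by
  refine Set.disjoint_left.2 fun x hx hx' => (hx.1.trans hx'.2).not_gt ?_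
  rw [lt_div_iff₀ hc]
  linarith

section Distinguish

variable {h M L L' K : ℕ} {ρ : ℝ≥0∞} {A : QueryAlgorithm} {c : ℝ}

lemma exists_probWithin_univ_le (hh : 2 ≤ h) (hρ : LazyBound h M L K ρ)
    (hρ' : LazyBound h M L' K ρ) (hL : L ≤ M) (hL' : L' ≤ M) (hpow : 11 / 12 < ρ ^ K) (hc : 0 < c)
    (hdeg : c ^ 2 * cliqueMatchingDeg h L' < cliqueMatchingDeg h L)
    (hA : ∀ G : InputGraph, 2 / 3 < A.prob G (approxSet c G.avgDeg)) :
    ∃ I : Finset ℕ, I.card = L ∧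
      A.probWithin (cliqueMatchingInput hh I) K Set.univ ≤ 3 / 4 := by
  by_contra! hslow
  have hx (I : Finset ℕ) (hI : I.card = L) :
      5 / 12 ≤ A.probWithin (cliqueMatchingInput hh I) K (approxSet c (cliqueMatchingDeg h L)) := by
    have hcorrect := hA (cliqueMatchingInput hh I)
    rw [avgDeg_cliqueMatchingInput, hI] at hcorrect
    have hsum := (add_le_add hcorrect.le (hslow I hI).le).trans (A.prob_add_probWithin_le _ _ K)
    rw [show (2 / 3 : ℝ≥0∞) + 3 / 4 = 1 + 5 / 12 by
      rw [← ENNReal.toReal_eq_toReal_iff' (by finiteness) (by finiteness),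
        ENNReal.toReal_add (by finiteness) (by finiteness),
        ENNReal.toReal_add (by finiteness) (by finiteness)]
      norm_num [ENNReal.toReal_div]] at hsum
    exact (ENNReal.add_le_add_iff_left ENNReal.one_ne_top).1 hsum
  have hy (I : Finset ℕ) (hI : I.card = L') :
      A.probWithin (cliqueMatchingInput hh I) K (approxSet c (cliqueMatchingDeg h L)) ≤ 1 / 3 := by
    have hcorrect := hA (cliqueMatchingInput hh I)
    rw [avgDeg_cliqueMatchingInput, hI] at hcorrect
    have hone : (1 : ℝ≥0∞) = 1 / 3 + 2 / 3 := by
      rw [← ENNReal.toReal_eq_toReal_iff' (by finiteness) (by finiteness),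
        ENNReal.toReal_add (by finiteness) (by finiteness)]
      norm_num [ENNReal.toReal_div]
    have hsum := ((add_le_add_right hcorrect.le _).trans
      (A.probWithin_add_prob_le (cliqueMatchingInput hh I) (disjoint_approxSet hc hdeg) K)).trans_eq
        hone
    exact (ENNReal.add_le_add_iff_right (by finiteness)).1 hsum
  refine hpow.not_ge ((pow_le_of_distinguishes hh hρ hρ' hL hL' hx hy).trans_eq ?_)
  rw [← ENNReal.toReal_eq_toReal_iff' (by finiteness) (by finiteness),
    ENNReal.toReal_add (by finiteness) (by finiteness), ENNReal.toReal_sub_of_le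
      (ENNReal.div_le_of_le_mul (by norm_num)) (by finiteness)]
  norm_num [ENNReal.toReal_div]

end Distinguish

lemma LazyBound.of_real {h M L K : ℕ} {δ : ℝ} (hδ0 : 0 ≤ δ) (hδ1 : δ ≤ 1) (hKL : K ≤ L)
    (hKM : K < M) (hvertex : (h : ℝ) + 2 * K ≤ δ * (h + 2 * L))
    (hedge : (L : ℝ) ≤ δ * (h.choose 2 + L)) (habsent : (L : ℝ) ≤ δ * (M - K)) :
    LazyBound h M L K (ENNReal.ofReal (1 - δ)) := by
  have hcast {a b : ℕ} (hab : (1 - δ) * (a : ℝ) ≤ b) :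
      ENNReal.ofReal (1 - δ) * (a : ℝ≥0∞) ≤ (b : ℝ≥0∞) := by
    rw [← ENNReal.ofReal_natCast, ← ENNReal.ofReal_natCast,
      ← ENNReal.ofReal_mul (sub_nonneg.2 hδ1)]
    exact ENNReal.ofReal_le_ofReal hab
  refine ⟨ENNReal.ofReal_le_one.2 (sub_le_self 1 hδ0), hKL, hKM, hcast ?_, hcast ?_,
    fun N hN => hcast ?_⟩
  · push_cast [hKL]
    linarith
  · push_cast
    linarith
  · have hMN : (M : ℝ) ≤ N + K := by exact_mod_cast hN
    have hLδ : (L : ℝ) ≤ δ * N := habsent.trans (mul_le_mul_of_nonneg_left (by linarith) hδ0)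
    have hLN : L ≤ N := by exact_mod_cast hLδ.trans (mul_le_of_le_one_left N.cast_nonneg hδ1)
    rw [Nat.cast_sub hLN]
    linarith

/-- The sizes of the hard inputs on `n` vertices: `a` is of order `n ^ (1 / 3)`, the clique has
`h` vertices, where `h` is `a ^ 2` up to parity, and `L` is the number of matching edges. The factor
`R` between the numbers of matching edges of the two kinds of hard inputs is small compared to
`a`. -/
structure HardSizes (R n a h L : ℕ) : Prop where
  R_pos : 1 ≤ R
  le_a : 64 * R ≤ a
  n_le : n ≤ a ^ 3
  le_n : a ^ 3 ≤ 8 * n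
  le_h : a ^ 2 ≤ h
  h_le : h ≤ a ^ 2 + 1
  n_eq : h + 2 * L = n

namespace HardSizes

variable {R n a h L l K : ℕ} (H : HardSizes R n a h L)
include H

lemma le_sq : 64 * a ≤ a ^ 2 := by
  rw [sq]
  exact Nat.mul_le_mul_right a (by have := H.R_pos; have := H.le_a; omega)

lemma a_pos : 0 < a := by
  have := H.R_pos
  have := H.le_a
  omega

lemma two_le_h : 2 ≤ h := by
  have := H.a_pos
  have := H.le_sq
  have := H.le_h
  omega

lemma sq_le : 8 * a ^ 2 ≤ n := by
  have hcube : 64 * a ^ 2 ≤ a ^ 3 := by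
    rw [pow_succ' a 2]
    exact Nat.mul_le_mul_right _ (by have := H.R_pos; have := H.le_a; omega)
  have := H.le_n
  omega

lemma a_le : a ≤ L := by
  have := H.a_pos
  have := H.le_sq
  have := H.sq_le
  have := H.h_le
  have := H.n_eq
  omega

lemma pow_four_le : (a : ℝ) ^ 4 ≤ 4 * h.choose 2 := by
  have hh : (a : ℝ) ^ 2 ≤ h := by exact_mod_cast H.le_h
  have ha : (64 : ℝ) ≤ a ^ 2 := by
    exact_mod_cast (Nat.mul_le_mul_left 64 H.a_pos).trans H.le_sq
  rw [Nat.cast_choose_two]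
  nlinarith

lemma cube_le : 64 * (R * (a : ℝ) ^ 3) ≤ a ^ 4 := by
  have ha : (64 * R : ℝ) ≤ a := by exact_mod_cast H.le_a
  calc _ = 64 * R * (a : ℝ) ^ 3 := by ring
    _ ≤ a * a ^ 3 := by gcongr
    _ = a ^ 4 := by ring

lemma mul_n_le : (R * n : ℝ) ≤ R * a ^ 3 := by
  have hn : (n : ℝ) ≤ a ^ 3 := by exact_mod_cast H.n_le
  gcongr

lemma lazyBound (hK : K ≤ a) (hl : L ≤ l) (hl' : l ≤ R * n) :
    LazyBound h (K + R * n * a) l K (ENNReal.ofReal (1 - 32 * R / a)) := by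
  have ha0 : (0 : ℝ) < a := Nat.cast_pos.2 H.a_pos
  have ha : (64 * R : ℝ) ≤ a := by exact_mod_cast H.le_a
  have hR : (1 : ℝ) ≤ R := by exact_mod_cast H.R_pos
  have hlR : (l : ℝ) ≤ R * n := by exact_mod_cast hl'
  have hn : 0 < n := by have := H.n_eq; have := H.two_le_h; omega
  refine LazyBound.of_real (by positivity) ?_ (hK.trans (H.a_le.trans hl))
    (Nat.lt_add_of_pos_right (Nat.mul_pos (Nat.mul_pos H.R_pos hn) H.a_pos)) ?_ ?_ ?_
  · rw [div_le_one ha0]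
    linarith
  · rw [div_mul_eq_mul_div, le_div_iff₀ ha0]
    have hsum : (h : ℝ) + 2 * K ≤ 4 * a ^ 2 := by
      have := H.h_le
      have := H.le_sq
      have := H.a_pos
      exact_mod_cast (by omega : h + 2 * K ≤ 4 * a ^ 2)
    have hcube : (a : ℝ) ^ 3 ≤ 8 * (h + 2 * l) := by
      have := H.le_n
      have := H.n_eq
      exact_mod_cast (by omega : a ^ 3 ≤ 8 * (h + 2 * l))
    calc ((h : ℝ) + 2 * K) * a ≤ 4 * a ^ 2 * a := by gcongr
      _ = 4 * 1 * a ^ 3 := by ring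
      _ ≤ 4 * R * (8 * (h + 2 * l)) := by gcongr
      _ = 32 * R * (h + 2 * l) := by ring
  · rw [div_mul_eq_mul_div, le_div_iff₀ ha0]
    calc (l : ℝ) * a ≤ R * a ^ 3 * a := by gcongr; exact hlR.trans H.mul_n_le
      _ = R * a ^ 4 := by ring
      _ ≤ R * (4 * h.choose 2) := by gcongr; exact H.pow_four_le
      _ ≤ R * (32 * (h.choose 2 + l)) := by
        gcongr
        · norm_num
        · exact le_add_of_nonneg_right l.cast_nonneg
      _ = 32 * R * (h.choose 2 + l) := by ring
  · push_cast
    rw [add_sub_cancel_left, div_mul_eq_mul_div, le_div_iff₀ ha0, ← mul_assoc]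
    gcongr
    exact hlR.trans (le_mul_of_one_le_left (by positivity) (by linarith))

lemma sq_mul_cliqueMatchingDeg_lt {c : ℝ} (hc : c ^ 2 ≤ R) :
    c ^ 2 * cliqueMatchingDeg h (R * n) < cliqueMatchingDeg h L := by
  have hn : (0 : ℝ) < n := by
    exact_mod_cast (by have := H.n_eq; have := H.two_le_h; omega : 0 < n)
  have hR : (0 : ℝ) < R := by exact_mod_cast H.R_pos
  have ha : (0 : ℝ) < a := by exact_mod_cast H.a_pos
  have hedges : 2 * (R * n : ℝ) < h * (h - 1) := by
    have hpow := H.pow_four_le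
    rw [Nat.cast_choose_two] at hpow
    linarith [H.cube_le, H.mul_n_le, mul_pos hR (pow_pos ha 3)]
  have hdeg : cliqueMatchingDeg h L = ((h : ℝ) * (h - 1) + 2 * L) / n := by
    rw [cliqueMatchingDeg, ← H.n_eq]
    push_cast
    rfl
  have hedges_pos : 0 < (h : ℝ) * (h - 1) + 2 * (R * n) := by linarith [mul_pos hR hn]
  rw [hdeg, cliqueMatchingDeg]
  push_cast
  calc c ^ 2 * (((h : ℝ) * (h - 1) + 2 * (R * n)) / (h + 2 * (R * n)))
      ≤ R * (((h : ℝ) * (h - 1) + 2 * (R * n)) / (0 + 2 * (R * n))) := by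
        gcongr
        exact h.cast_nonneg
    _ = ((h : ℝ) * (h - 1) / 2 + R * n) / n := by
        field_simp
        ring
    _ < ((h : ℝ) * (h - 1) + 2 * L) / n := by
        refine div_lt_div_of_pos_right ?_ hn
        linarith [L.cast_nonneg (α := ℝ)]

end HardSizes

lemma exists_hardSizes {R n : ℕ} (hR : 1 ≤ R) (hn : (64 * R) ^ 3 ≤ n) :
    ∃ a h L, HardSizes R n a h L ∧
      400 * R * ⌊1 / (400 * R) * (n : ℝ) ^ (1 / 3 : ℝ)⌋₊ ≤ a := by
  set r : ℝ := (n : ℝ) ^ (1 / 3 : ℝ) with hr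
  have hr3 : r ^ 3 = n := by
    rw [hr, ← Real.rpow_natCast, ← Real.rpow_mul n.cast_nonneg]
    norm_num
  have hr0 : 0 ≤ r := by positivity
  have hR' : (1 : ℝ) ≤ R := by exact_mod_cast hR
  have hrR : 64 * (R : ℝ) ≤ r := by
    refine le_of_pow_le_pow_left₀ (n := 3) (by norm_num) hr0 ?_
    rw [hr3]
    exact_mod_cast hn
  set a := ⌈r⌉₊
  have hra : r ≤ a := Nat.le_ceil r
  have har : (a : ℝ) < r + 1 := Nat.ceil_lt_add_one hr0
  have haR : 64 * R ≤ a := by exact_mod_cast hrR.trans hra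
  have hna : n ≤ a ^ 3 := by
    have : (n : ℝ) ≤ a ^ 3 := by rw [← hr3]; gcongr
    exact_mod_cast this
  have han : a ^ 3 ≤ 8 * n := by
    have : (a : ℝ) ^ 3 ≤ 8 * n := by
      rw [← hr3, show 8 * r ^ 3 = (2 * r) ^ 3 by ring]
      gcongr
      linarith
    exact_mod_cast this
  have hcube : 64 * a ^ 2 ≤ a ^ 3 := by
    rw [pow_succ' a 2]
    exact Nat.mul_le_mul_right _ (by omega)
  refine ⟨a, a ^ 2 + (n + a ^ 2) % 2, (n - (a ^ 2 + (n + a ^ 2) % 2)) / 2,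
    ⟨hR, haR, hna, han, by omega, by omega, ?_⟩, ?_⟩
  · have : 0 < a ^ 2 := pow_pos (by omega) 2
    omega
  · have hfloor : (⌊1 / (400 * R) * r⌋₊ : ℝ) ≤ 1 / (400 * R) * r := Nat.floor_le (by positivity)
    have : (400 * R * ⌊1 / (400 * R) * r⌋₊ : ℝ) ≤ a :=
      calc _ ≤ 400 * R * (1 / (400 * R) * r) := by gcongr
        _ = r := by field_simp
        _ ≤ a := hra
    exact_mod_cast this

lemma lt_ofReal_pow {a K R : ℕ} (hR : 1 ≤ R) (ha : 64 * R ≤ a) (hK : 400 * R * K ≤ a) :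
    11 / 12 < ENNReal.ofReal (1 - 32 * R / a) ^ K := by
  have ha' : (64 * R : ℝ) ≤ a := by exact_mod_cast ha
  have hK' : (400 * R * K : ℝ) ≤ a := by exact_mod_cast hK
  have ha0 : (0 : ℝ) < a := by exact_mod_cast (by omega : 0 < a)
  set δ : ℝ := 32 * R / a
  have hδ : δ ≤ 1 / 2 := by
    rw [div_le_div_iff₀ ha0 two_pos]
    linarith
  have hKδ : K * δ ≤ 2 / 25 := by
    rw [mul_div_assoc', div_le_div_iff₀ ha0 (by norm_num)]
    linarith
  have hbernoulli : 1 + K * -δ ≤ (1 + -δ) ^ K := one_add_mul_le_pow (by linarith) K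
  rw [← ENNReal.ofReal_pow (by linarith), ENNReal.lt_ofReal_iff_toReal_lt (by finiteness),
    sub_eq_add_neg]
  refine lt_of_lt_of_le ?_ hbernoulli
  norm_num [ENNReal.toReal_div]
  linarith

theorem exists_probWithin_univ_le_of_approx :
    ∀ c : ℝ, 1 ≤ c → ∃ (κ : ℝ) (n₀ : ℕ), 0 < κ ∧ ∀ A : QueryAlgorithm,
      (∀ G : InputGraph, 2 / 3 < A.prob G {x | G.avgDeg / c ≤ x ∧ x ≤ c * G.avgDeg}) →
      ∀ n : ℕ, n₀ ≤ n → ∃ G : InputGraph, G.n = n ∧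
        A.probWithin G ⌊κ * (n : ℝ) ^ (1 / 3 : ℝ)⌋₊ Set.univ ≤ 3 / 4 := by
  intro c hc
  obtain ⟨R, hcR⟩ : ∃ R : ℕ, c ^ 2 ≤ R := exists_nat_ge _
  have hR : 1 ≤ R := by exact_mod_cast (one_le_pow₀ hc).trans hcR
  refine ⟨1 / (400 * R), (64 * R) ^ 3, by positivity, fun A hA n hn => ?_⟩
  obtain ⟨a, h, L, H, hK⟩ := exists_hardSizes hR hn
  set K := ⌊1 / (400 * R) * (n : ℝ) ^ (1 / 3 : ℝ)⌋₊
  have hKa : K ≤ a := (Nat.le_mul_of_pos_left K (by omega)).trans hK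
  have hLR : L ≤ R * n := by
    have := H.n_eq
    exact (by omega : L ≤ n).trans (Nat.le_mul_of_pos_left n hR)
  have hRM : R * n ≤ K + R * n * a := (Nat.le_mul_of_pos_right _ H.a_pos).trans le_add_self
  obtain ⟨I, hI, hprob⟩ := exists_probWithin_univ_le H.two_le_h (H.lazyBound hKa le_rfl hLR)
    (H.lazyBound hKa hLR le_rfl) (hLR.trans hRM) hRM (lt_ofReal_pow hR H.le_a hK)
    (by linarith) (H.sq_mul_cliqueMatchingDeg_lt hcR) hA
  exact ⟨cliqueMatchingInput H.two_le_h I, by rw [n_cliqueMatchingInput, hI, H.n_eq], hprob⟩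

end LowerBound

end

theorem theorem1p3 :
    -- (a) upper bound: base model with random edge samples, `n` unknown
    (∃ (C : ℝ) (p : ℕ), 0 < C ∧ ∀ ε : ℝ, 0 < ε → ε < 1 →
      ∃ A : QueryAlgorithm, A.InBaseModelWithRandEdge ∧ ∀ G : InputGraph,
        99 / 100 < A.probWithin G
            ⌊C * (1 + Real.log G.n) ^ p *
              (ε⁻¹ ^ 2 * min G.avgDeg (Real.sqrt (G.n / G.avgDeg)))⌋₊
            {x | |x - G.avgDeg| ≤ ε * G.avgDeg} ∧
        99 / 100 < A.probWithin G
            ⌊C * (1 + Real.log G.n) ^ p * (ε⁻¹ ^ 2 * (G.n : ℝ) ^ (1 / 3 : ℝ))⌋₊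
            {x | |x - G.avgDeg| ≤ ε * G.avgDeg}) ∧
    -- (b) lower bound: all queries, including full neighborhoods and random edges, `n` unknown
    (∀ c : ℝ, 1 ≤ c → ∃ (κ : ℝ) (n₀ : ℕ), 0 < κ ∧ ∀ A : QueryAlgorithm,
      (∀ G : InputGraph, 2 / 3 < A.prob G {x | G.avgDeg / c ≤ x ∧ x ≤ c * G.avgDeg}) →
      ∀ n : ℕ, n₀ ≤ n → ∃ G : InputGraph, G.n = n ∧
        A.probWithin G ⌊κ * (n : ℝ) ^ (1 / 3 : ℝ)⌋₊ Set.univ ≤ 3 / 4) :=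
  ⟨exists_queryAlgorithm_lt_probWithin, exists_probWithin_univ_le_of_approx⟩
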